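/- Let $G=(V,E,m,\mu)$ be a connected, locally finite weighted graph (self-loops allowed), with vertex weight $m:V\to(0,\infty)$ and symmetric edge weight $\mu:V\times V\to[0,\infty)$, where $x\sim y$ if and only if $\mu_{xy}>0$. For $f,g:V\to\mathbb R$ put $$\Delta f(x)=\frac1{m(x)}\sum_{y\sim x}\mu_{xy}(f(y)-f(x)),\qquad \Gamma(f,g)=\tfrac12\big(\Delta(fg)-f\Delta g-g\Delta f\big),$$ $$\Gamma_2(f,g)=\tfrac12\big(\Delta\Gamma(f,g)-\Gamma(f,\Delta g)-\Gamma(g,\Delta f)\big),\qquad \Gamma(f)=\Gamma(f,f),\quad \Gamma_2(f)=\Gamma_2(f,f).$$ Let $C_0(V)$ be the set of finitely supported functions $V\to\mathbb R$, let $Q(f,g)=\frac12\sum_{x,y\in V}\mu_{xy}(f(y)-f(x))(g(y)-g(x))$ and $Q(f)=Q(f,f)$. Let the form domain $D(Q)$ be the closure of $C_0(V)$ in $\{f\in\ell^2(V,m): Q(f)<\infty\}$ for the norm $\|f\|_Q=(\|f\|_{\ell^2(V,m)}^2+Q(f))^{1/2}$. Let $L$ be the associated Laplacian, i.e. the self-adjoint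 nonpositive operator on $\ell^2(V,m)$ such that $f\in D(L)$ and $Lf=g$ if and only if $f\in D(Q)$, $g\in\ell^2(V,m)$, and $Q(f,v)=-\langle g,v\rangle_{\ell^2(V,m)}$ for all $v\in D(Q)$. Let $P_t=e^{tL}$, $t\ge0$, be the strongly continuous semigroup on $\ell^2(V,m)$ generated by $L$. Assume that $G$ is complete, i.e. there is a nondecreasing sequence $(\eta_k)_{k\ge1}$ in $C_0(V)$ that converges pointwise to $1$ and satisfies $\Gamma(\eta_k)\le\frac1k$ on $V$ for all $k\ge1$. Assume also that $m$ is non-degenerate, i.e. $m\geq\delta$ on $V$ for some constant $\delta>0$. Let $K\in\mathbb R$. Then the following are equivalent: (a) $G$ satisfies $CD(K,\infty)$: $\Gamma_2(f)(x)\ge K\,\Gamma(f)(x)$ for all $f:V\to\mathbb R$ and all $x\in V$. (b) For every $f\in C_0(V)$, $\Gamma(f)\in\ell^2(V,m)$ and $\Gamma(P_tf)\le e^{-2Kt}P_t(\Gamma(f))$ on $V$ for all $t\ge0$. (c) For every $f\in D(Q)$, $\Gamma(f)\in\ell^2(V,m)$ and $\Gamma(P_tf)\le e^{-2Kt}P_t(\Gamma(f))$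 on $V$ for all $t\ge0$. -/

import Mathlib

open Filter Topology MeasureTheory
open scoped NNReal ENNReal

/-- A locally finite weighted graph `(V, E, m, μ)`, possibly with self-loops. The symmetric edge
weight is extended by zero to `V × V`, so that the edge set is `E = {(x, y) | 0 < μ x y}`. -/
structure WeightedGraph (V : Type*) where
  /-- vertex weight -/
  m : V → ℝ
  /-- edge weight -/
  μ : V → V → ℝ
  m_pos : ∀ x, 0 < m x
  μ_nonneg : ∀ x y, 0 ≤ μ x y
  μ_symm : ∀ x y, μ x y = μ y x
  locallyFinite : ∀ x, {y | 0 < μ x y}.Finite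

/-- A strongly continuous one-parameter semigroup of bounded operators on a normed space. -/
structure C0Semigroup (X : Type*) [NormedAddCommGroup X] [NormedSpace ℝ X] where
  /-- the operator at time `t` -/
  op : ℝ≥0 → X →L[ℝ] X
  op_zero : op 0 = ContinuousLinearMap.id ℝ X
  op_add : ∀ s t, op (s + t) = (op s).comp (op t)
  continuous_orbit : ∀ f, Continuous fun t => op t f

namespace C0Semigroup

variable {X : Type*} [NormedAddCommGroup X] [NormedSpace ℝ X]

instance : Nonempty (C0Semigroup X) :=
  ⟨{ op := fun _ => ContinuousLinearMap.id ℝ X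
     op_zero := rfl
     op_add := fun _ _ => rfl
     continuous_orbit := fun _ => continuous_const }⟩

/-- The (possibly unbounded) operator with graph `A` is the infinitesimal generator of `T`:
`(f, g) ∈ A` iff `(T_t f - f) / t → g` in norm as `t ↓ 0`. -/
def HasGenerator (T : C0Semigroup X) (A : Set (X × X)) : Prop :=
  ∀ f g : X, (f, g) ∈ A ↔
    Tendsto (fun t : ℝ≥0 => (t : ℝ)⁻¹ • (T.op t f - f)) (𝓝[>] 0) (𝓝 g)

end C0Semigroup

namespace WeightedGraph

variable {V : Type*} (G : WeightedGraph V)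

/-- Neighbours. -/
def Adj (x y : V) : Prop := 0 < G.μ x y

/-- Any two vertices are joined by a finite path. -/
def Connected : Prop := ∀ x y, Relation.ReflTransGen G.Adj x y

/-- The vertex measure is bounded below by a positive constant. -/
def NonDegenerate : Prop := ∃ δ : ℝ, 0 < δ ∧ ∀ x, δ ≤ G.m x

/-- The finite set of neighbours of a vertex. -/
noncomputable def nbrs (x : V) : Finset V := (G.locallyFinite x).toFinset

/-- The formal Laplacian `Δ f (x) = (1 / m x) ∑_{y ∼ x} μ x y (f y - f x)`. -/
noncomputable def lap (f : V → ℝ) (x : V) : ℝ :=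
  (G.m x)⁻¹ * ∑ y ∈ G.nbrs x, G.μ x y * (f y - f x)

/-- The gradient form (carré du champ). -/
noncomputable def gammaForm (f g : V → ℝ) (x : V) : ℝ :=
  (G.lap (f * g) x - f x * G.lap g x - g x * G.lap f x) / 2

/-- `Γ(f) = Γ(f, f)`. -/
noncomputable def gamma (f : V → ℝ) : V → ℝ := G.gammaForm f f

/-- The iterated gradient form `Γ₂`. -/
noncomputable def gammaTwoForm (f g : V → ℝ) (x : V) : ℝ :=
  (G.lap (G.gammaForm f g) x - G.gammaForm f (G.lap g) x - G.gammaForm g (G.lap f) x) / 2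

/-- `Γ₂(f) = Γ₂(f, f)`. -/
noncomputable def gammaTwo (f : V → ℝ) : V → ℝ := G.gammaTwoForm f f

/-- The curvature dimension condition `CD(K, ∞)`. -/
def CD (K : ℝ) : Prop := ∀ (f : V → ℝ) (x : V), K * G.gamma f x ≤ G.gammaTwo f x

/-- Completeness: there are finitely supported `η_1 ≤ η_2 ≤ ⋯` converging pointwise to `1`
with `Γ(η_k) ≤ 1 / k`; here `η k` is the function with index `k + 1`. -/
def Complete : Prop :=
  ∃ η : ℕ → V → ℝ, (∀ k, (Function.support (η k)).Finite) ∧ Monotone η ∧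
    (∀ x, Tendsto (fun k => η k x) atTop (𝓝 1)) ∧
    ∀ k x, G.gamma (η k) x ≤ 1 / ((k : ℝ) + 1)

/-- Finiteness of `∑_{x,y} μ x y (f y - f x)²`. -/
def FiniteEnergy (f : V → ℝ) : Prop :=
  Summable fun p : V × V => G.μ p.1 p.2 * (f p.2 - f p.1) ^ 2

/-- The form `Q(f, g) = ½ ∑_{x,y} μ x y (f y - f x) (g y - g x)`, which converges absolutely for
functions of finite energy. -/
noncomputable def energy (f g : V → ℝ) : ℝ :=
  (∑' p : V × V, G.μ p.1 p.2 * (f p.2 - f p.1) * (g p.2 - g p.1)) / 2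

/-- The `ℓ²(V, m)` pairing `∑_x m x f x g x`. -/
noncomputable def pairing (f g : V → ℝ) : ℝ := ∑' x, G.m x * f x * g x

variable [MeasurableSpace V]

/-- The measure on `V` with mass `m x` at the vertex `x`. -/
noncomputable def vertexMeasure : Measure V :=
  Measure.sum fun x => ENNReal.ofReal (G.m x) • Measure.dirac x

/-- The Hilbert space `ℓ²(V, m)`. When all sets are measurable, the only null set is empty, so
that its elements are functions on `V`. -/
abbrev L2 : Type _ := Lp ℝ 2 G.vertexMeasure

/-- The form domain `D(Q)`: the closure of the finitely supported functions, with respect to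
`‖f‖_Q = (‖f‖² + Q(f))^{1/2}`, within the functions in `ℓ²(V, m)` of finite energy. -/
def formDomain : Set (V → ℝ) :=
  {f | MemLp f 2 G.vertexMeasure ∧ G.FiniteEnergy f ∧
    ∃ φ : ℕ → V → ℝ, (∀ n, (Function.support (φ n)).Finite) ∧
      Tendsto (fun n => G.pairing (φ n - f) (φ n - f) + G.energy (φ n - f) (φ n - f))
        atTop (𝓝 0)}

/-- The graph of the Laplacian `L`, the self-adjoint nonpositive operator associated with the
Dirichlet form `Q`: `f ∈ D(L)` and `L f = g` iff `f ∈ D(Q)` and `Q(f, v) = -⟨g, v⟩` for all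
`v ∈ D(Q)`. -/
def laplacianGraph : Set (G.L2 × G.L2) :=
  {p | (p.1 : V → ℝ) ∈ G.formDomain ∧
    ∀ v ∈ G.formDomain, G.energy p.1 v = -G.pairing p.2 v}

/-- The heat semigroup `P_t = e^{tL}`: the strongly continuous semigroup on `ℓ²(V, m)` whose
generator is `L`. It exists as `L` is self-adjoint and nonpositive, and it is unique since a
semigroup is determined by its generator. -/
noncomputable def heatSemigroup : C0Semigroup G.L2 :=
  Classical.epsilon fun T => T.HasGenerator G.laplacianGraph

/-- `P_t f` as a function on `V`, for `f ∈ ℓ²(V, m)`. -/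
noncomputable def heat (t : ℝ≥0) (f : V → ℝ) (hf : MemLp f 2 G.vertexMeasure) : V → ℝ :=
  G.heatSemigroup.op t (hf.toLp f)

/-- The gradient bound `Γ(P_t f) ≤ e^{-2Kt} P_t(Γ f)` on `V` for all `t ≥ 0`. -/
def GradientBound (K : ℝ) (f : V → ℝ) : Prop :=
  ∃ (hf : MemLp f 2 G.vertexMeasure) (hΓ : MemLp (G.gamma f) 2 G.vertexMeasure),
    ∀ (t : ℝ≥0) (x : V),
      G.gamma (G.heat t f hf) x ≤ Real.exp (-2 * K * t) * G.heat t (G.gamma f) hΓ x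

end WeightedGraph

/-!
The proof is the semigroup interpolation of Bakry and Émery. For finitely supported `f` and
`g = 1_x`, consider `F(s) = ⟪Γ(P_{t-s} f), P_s g⟫`. Its derivative is
`⟪Γ(u), L P_s g⟫ - 2 ⟪Γ(u, L u), P_s g⟫` with `u = P_{t-s} f`, and if the Laplacian may be moved
from `P_s g` to `Γ(u)`, then `CD(K, ∞)` and `P_s g ≥ 0` give `F' ≥ 2 K F`. Comparing `F(0)` with
`F(t)` is the gradient bound at `x` (`CD.tsum_gamma_orbit_le`, `CD.gamma_orbit_le`). Conversely,
the derivative of the gradient bound at `t = 0` is `CD(K, ∞)` for finitely supported functions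
(`CD.of_gradientBound`), and this suffices as `Γ₂(f)(x)` only sees a finite ball.

The Laplacian is unbounded, so that moving it is the main point (`CD.weak`). The curvature
condition says that `w = Γ(u)` satisfies `Δ w ≥ h := 2 K Γ(u) + 2 Γ(u, L u)` pointwise. Both `w`
and `h` lie in `ℓ¹`, because `u` and `L u` have finite energy, and `w` is bounded, because `m` is
bounded below. Testing the inequality with `η_k² w`, for the cut-off functions `η_k` of a complete
graph, shows that `w` has finite energy (`IsCutoff.finiteEnergy_of_le_lap`). On a complete graph
every function in `ℓ²` of finite energy is in the form domain
(`Complete.mem_formDomain_iff`), so that `-Q(w, P_s g) = ⟪w, L P_s g⟫`; testing with `η_k P_s g` and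
letting `k → ∞` gives the weak form of the inequality (`IsCutoff.tsum_le_inner`).

For finitely supported `f` also `L f` is finitely supported; hence `P_r f` is in the domain of
`L²`, and `r ↦ d P_r f` is differentiable in `ℓ²` over the edges, since `d (1 - L)⁻¹` is bounded
(`gradResolvent`). The passage to the whole form domain is by density
(`gradientBound_of_mem_formDomain`): `Γ` is continuous from the form domain to `ℓ¹ ⊆ ℓ²`.

The existence of the heat semigroup is shown from the Hille–Yosida theorem in a Hilbert space
(`DissipativeRelation.exists_hasGenerator`), proved with Yosida approximations; the range condition
is Riesz's theorem in the form domain (`exists_resolvent`). Positivity of the semigroup follows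
from `d/ds ‖u⁻‖² = 2 Q(u, u⁻) ≤ 0` (`orbit_nonneg`).
-/

/-! ### M-dissipative operators in a Hilbert space and their Yosida approximations -/

namespace DissipativeRelation

variable {H : Type*} [NormedAddCommGroup H] [InnerProductSpace ℝ H]

/-- The relation with graph `A` is dissipative, i.e. `⟪g, f⟫ ≤ 0` for `(f, g) ∈ A`, and `1 - c A`
is onto for every `c > 0`. -/
structure IsMDissipative (A : Submodule ℝ (H × H)) : Prop where
  inner_nonpos : ∀ p ∈ A, inner ℝ p.2 p.1 ≤ 0
  exists_resolvent : ∀ c : ℝ, 0 < c → ∀ h : H, ∃ p ∈ A, p.1 - c • p.2 = h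

variable {A : Submodule ℝ (H × H)}

theorem norm_le_of_sub_smul (hA : IsMDissipative A) {c : ℝ} (hc : 0 < c) {p : H × H} (hp : p ∈ A) :
    ‖p.1‖ ≤ ‖p.1 - c • p.2‖ := by
  have h1 := hA.inner_nonpos p hp
  have h2 : ‖p.1‖ * ‖p.1‖ ≤ ‖p.1 - c • p.2‖ * ‖p.1‖ := by
    refine le_trans ?_ (real_inner_le_norm _ _)
    rw [inner_sub_left, real_inner_self_eq_norm_mul_norm, inner_smul_left]
    simp only [conj_trivial]
    nlinarith
  by_cases h0 : ‖p.1‖ = 0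
  · rw [h0]; exact norm_nonneg _
  · exact le_of_mul_le_mul_right h2 (lt_of_le_of_ne (norm_nonneg _) (Ne.symm h0))

theorem eq_zero_of_sub_smul (hA : IsMDissipative A) {c : ℝ} (hc : 0 < c) {p : H × H} (hp : p ∈ A)
    (h : p.1 - c • p.2 = 0) : p = 0 := by
  have h1 : p.1 = 0 := by
    have := norm_le_of_sub_smul hA hc hp
    rw [h, norm_zero] at this
    exact norm_le_zero_iff.1 this
  have h2 : p.2 = 0 := by
    rw [h1, zero_sub, neg_eq_zero] at h
    exact (smul_eq_zero.1 h).resolve_left hc.ne'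
  exact Prod.ext h1 h2

theorem eq_of_sub_smul (hA : IsMDissipative A) {c : ℝ} (hc : 0 < c) {p q : H × H} (hp : p ∈ A)
    (hq : q ∈ A) (h : p.1 - c • p.2 = q.1 - c • q.2) : p = q := by
  rw [← sub_eq_zero]
  refine eq_zero_of_sub_smul hA hc (A.sub_mem hp hq) ?_
  rw [Prod.fst_sub, Prod.snd_sub, smul_sub, ← sub_eq_zero.2 h]
  abel

/-- The solution `p ∈ A` of `p.1 - c p.2 = h`. -/
noncomputable def resolventPair (hA : IsMDissipative A) {c : ℝ} (hc : 0 < c) (h : H) : H × H :=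
  (hA.exists_resolvent c hc h).choose

theorem resolventPair_mem (hA : IsMDissipative A) {c : ℝ} (hc : 0 < c) (h : H) :
    resolventPair hA hc h ∈ A := (hA.exists_resolvent c hc h).choose_spec.1

theorem resolventPair_eq (hA : IsMDissipative A) {c : ℝ} (hc : 0 < c) (h : H) :
    (resolventPair hA hc h).1 - c • (resolventPair hA hc h).2 = h :=
  (hA.exists_resolvent c hc h).choose_spec.2

theorem resolventPair_unique (hA : IsMDissipative A) {c : ℝ} (hc : 0 < c) {h : H} {p : H × H}
    (hp : p ∈ A) (h' : p.1 - c • p.2 = h) : resolventPair hA hc h = p :=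
  eq_of_sub_smul hA hc (resolventPair_mem hA hc h) hp (by rw [resolventPair_eq, h'])

/-- The resolvent `(1 - c A)⁻¹`. -/
noncomputable def resolvent (hA : IsMDissipative A) {c : ℝ} (hc : 0 < c) : H →L[ℝ] H :=
  LinearMap.mkContinuous
    { toFun := fun h => (resolventPair hA hc h).1
      map_add' := fun x y => by
        rw [resolventPair_unique hA hc (A.add_mem (resolventPair_mem hA hc x)
          (resolventPair_mem hA hc y)) (h := x + y)]
        · rfl
        · rw [Prod.fst_add, Prod.snd_add, smul_add, add_sub_add_comm, resolventPair_eq,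
            resolventPair_eq]
      map_smul' := fun a x => by
        rw [resolventPair_unique hA hc (A.smul_mem a (resolventPair_mem hA hc x)) (h := a • x)]
        · rfl
        · rw [Prod.smul_fst, Prod.smul_snd, smul_comm, ← smul_sub, resolventPair_eq] }
    1 fun h => by
      have := norm_le_of_sub_smul hA hc (resolventPair_mem hA hc h)
      rw [resolventPair_eq] at this
      simpa using this

theorem resolvent_apply_eq (hA : IsMDissipative A) {c : ℝ} (hc : 0 < c) {h : H} {p : H × H}
    (hp : p ∈ A) (h' : p.1 - c • p.2 = h) : resolvent hA hc h = p.1 := by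
  change (resolventPair hA hc h).1 = _
  rw [resolventPair_unique hA hc hp h']

theorem norm_resolvent_apply_le (hA : IsMDissipative A) {c : ℝ} (hc : 0 < c) (h : H) :
    ‖resolvent hA hc h‖ ≤ ‖h‖ := by
  have := norm_le_of_sub_smul hA hc (resolventPair_mem hA hc h)
  rwa [resolventPair_eq] at this

/-- The Yosida approximation `A (1 - c A)⁻¹ = ((1 - c A)⁻¹ - 1) / c`. -/
noncomputable def yosida (hA : IsMDissipative A) {c : ℝ} (hc : 0 < c) : H →L[ℝ] H :=
  c⁻¹ • (resolvent hA hc - 1)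

theorem resolvent_mem (hA : IsMDissipative A) {c : ℝ} (hc : 0 < c) (h : H) :
    (resolvent hA hc h, yosida hA hc h) ∈ A := by
  have h1 : yosida hA hc h = (resolventPair hA hc h).2 := by
    change c⁻¹ • ((resolventPair hA hc h).1 - h) = _
    rw [inv_smul_eq_iff₀ hc.ne']
    nth_rewrite 2 [← resolventPair_eq hA hc h]
    abel
  rw [h1]
  exact resolventPair_mem hA hc h

theorem yosida_eq (hA : IsMDissipative A) {c : ℝ} (hc : 0 < c) (h : H) :
    c • yosida hA hc h = resolvent hA hc h - h := by
  change c • c⁻¹ • (resolvent hA hc h - h) = _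
  rw [smul_inv_smul₀ hc.ne']

/-- On the domain of `A`, the resolvent intertwines `A` with the Yosida approximation. -/
theorem resolvent_snd (hA : IsMDissipative A) {c : ℝ} (hc : 0 < c) {p : H × H} (hp : p ∈ A) :
    resolvent hA hc p.2 = yosida hA hc p.1 := by
  have h1 : (yosida hA hc p.1, c⁻¹ • (yosida hA hc p.1 - p.2)) ∈ A := by
    have := A.smul_mem c⁻¹ (A.sub_mem (resolvent_mem hA hc p.1) hp)
    rw [Prod.smul_def] at this
    exact this
  refine resolvent_apply_eq hA hc h1 ?_
  dsimp only
  rw [smul_inv_smul₀ hc.ne']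
  abel

theorem resolvent_mem_of_mem (hA : IsMDissipative A) {c : ℝ} (hc : 0 < c) {p : H × H}
    (hp : p ∈ A) : (resolvent hA hc p.1, resolvent hA hc p.2) ∈ A := by
  rw [resolvent_snd hA hc hp]
  exact resolvent_mem hA hc p.1

theorem commute_resolvent (hA : IsMDissipative A) {c d : ℝ} (hc : 0 < c) (hd : 0 < d) :
    Commute (resolvent hA hc) (resolvent hA hd) := by
  ext h
  change resolvent hA hc (resolvent hA hd h) = resolvent hA hd (resolvent hA hc h)
  refine resolvent_apply_eq hA hc (p := (_, _))
    (resolvent_mem_of_mem hA hd (p := (_, _)) (resolvent_mem hA hc h)) ?_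
  dsimp only
  rw [← map_smul, ← map_sub, yosida_eq, sub_sub_cancel]

theorem commute_yosida (hA : IsMDissipative A) {c d : ℝ} (hc : 0 < c) (hd : 0 < d) :
    Commute (yosida hA hc) (yosida hA hd) := by
  refine Commute.smul_left (Commute.smul_right ?_ _) _
  exact ((commute_resolvent hA hc hd).sub_left (Commute.one_left _)).sub_right
    ((Commute.one_right _))

theorem inner_yosida_nonpos (hA : IsMDissipative A) {c : ℝ} (hc : 0 < c) (h : H) :
    inner ℝ (yosida hA hc h) h ≤ 0 := by
  have h1 : inner ℝ (resolvent hA hc h) h ≤ ‖h‖ * ‖h‖ :=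
    (real_inner_le_norm _ _).trans
      (mul_le_mul_of_nonneg_right (norm_resolvent_apply_le hA hc h) (norm_nonneg _))
  change inner ℝ (c⁻¹ • (resolvent hA hc h - h)) h ≤ 0
  rw [inner_smul_left, inner_sub_left, real_inner_self_eq_norm_mul_norm]
  exact mul_nonpos_of_nonneg_of_nonpos (by simpa using hc.le) (by linarith)

theorem norm_yosida_le (hA : IsMDissipative A) {c : ℝ} (hc : 0 < c) {p : H × H} (hp : p ∈ A) :
    ‖yosida hA hc p.1‖ ≤ ‖p.2‖ := by
  rw [← resolvent_snd hA hc hp]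
  exact norm_resolvent_apply_le hA hc _

variable [CompleteSpace H]

/-- In a Hilbert space the domain of a single-valued m-dissipative operator is dense. -/
theorem dense_domain (hA : IsMDissipative A) (hs : ∀ g, ((0 : H), g) ∈ A → g = 0) :
    Dense (Prod.fst '' (A : Set (H × H))) := by
  have h1 : (A.map (LinearMap.fst ℝ H H)).topologicalClosure = ⊤ := by
    rw [Submodule.topologicalClosure_eq_top_iff, Submodule.eq_bot_iff]
    intro h hh
    obtain ⟨p, hp, hph⟩ := hA.exists_resolvent 1 one_pos h
    rw [one_smul] at hph
    have h2 : inner ℝ p.1 h = 0 := hh p.1 ⟨p, hp, rfl⟩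
    have h3 := hA.inner_nonpos p hp
    rw [← hph, inner_sub_right, real_inner_self_eq_norm_mul_norm, real_inner_comm] at h2
    have h4 : p.1 = 0 := by
      rw [← norm_eq_zero]; nlinarith [norm_nonneg p.1]
    have h5 : p.2 = 0 := hs _ (by rw [← h4]; exact hp)
    rw [← hph, h4, h5, sub_zero]
  have h6 := (Submodule.dense_iff_topologicalClosure_eq_top).2 h1
  exact h6

theorem hasDerivAt_exp_apply (B : H →L[ℝ] H) (h : H) (t : ℝ) :
    HasDerivAt (fun s : ℝ => NormedSpace.exp (s • B) h) (NormedSpace.exp (t • B) (B h)) t :=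
  (hasDerivAt_exp_smul_const B t).clm_apply (hasDerivAt_const t h) |>.congr_deriv (by simp)

theorem hasDerivAt_exp_apply' (B : H →L[ℝ] H) (h : H) (t : ℝ) :
    HasDerivAt (fun s : ℝ => NormedSpace.exp (s • B) h) (B (NormedSpace.exp (t • B) h)) t :=
  (hasDerivAt_exp_smul_const' B t).clm_apply (hasDerivAt_const t h) |>.congr_deriv (by simp)

theorem norm_exp_apply_le {B : H →L[ℝ] H} (hB : ∀ h, inner ℝ (B h) h ≤ 0) {t : ℝ} (ht : 0 ≤ t)
    (h : H) : ‖NormedSpace.exp (t • B) h‖ ≤ ‖h‖ := by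
  have hd : ∀ s : ℝ, HasDerivAt (fun s : ℝ => ‖NormedSpace.exp (s • B) h‖ ^ 2)
      (2 * inner ℝ (NormedSpace.exp (s • B) h) (B (NormedSpace.exp (s • B) h))) s :=
    fun s => (hasDerivAt_exp_apply' B h s).norm_sq
  have h1 : Antitone (fun s : ℝ => ‖NormedSpace.exp (s • B) h‖ ^ 2) := by
    refine antitone_of_deriv_nonpos (fun s => (hd s).differentiableAt) fun s => ?_
    rw [(hd s).deriv, real_inner_comm]
    linarith [hB (NormedSpace.exp (s • B) h)]
  have h2 := h1 ht
  simp only [zero_smul, NormedSpace.exp_zero, one_apply_eq_self] at h2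
  exact (pow_le_pow_iff_left₀ (norm_nonneg _) (norm_nonneg _) two_ne_zero).1 h2

/-- Duhamel's formula bounds the distance of two commuting contraction semigroups. -/
theorem norm_exp_apply_sub_le {B C : H →L[ℝ] H} (hBC : Commute B C)
    (hB : ∀ h, inner ℝ (B h) h ≤ 0) (hC : ∀ h, inner ℝ (C h) h ≤ 0) {t : ℝ} (ht : 0 ≤ t) (h : H) :
    ‖NormedSpace.exp (t • B) h - NormedSpace.exp (t • C) h‖ ≤ t * ‖B h - C h‖ := by
  have hd : ∀ s : ℝ, HasDerivAt
      (fun s : ℝ => (NormedSpace.exp (s • B) * NormedSpace.exp ((t - s) • C)) h)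
      (NormedSpace.exp (s • B) (NormedSpace.exp ((t - s) • C) (B h - C h))) s := by
    intro s
    have h1 := hasDerivAt_exp_smul_const B s
    have h2 : HasDerivAt (fun s : ℝ => NormedSpace.exp ((t - s) • C))
        (-(NormedSpace.exp ((t - s) • C) * C)) s := by
      have := (hasDerivAt_exp_smul_const C (t - s)).scomp s ((hasDerivAt_id s).const_sub t)
      exact this.congr_deriv (by simp)
    refine ((h1.mul h2).clm_apply (hasDerivAt_const s h)).congr_deriv ?_
    have hcomm : B * NormedSpace.exp ((t - s) • C) = NormedSpace.exp ((t - s) • C) * B := by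
      have : Commute B ((t - s) • C) := hBC.smul_right _
      exact this.exp_right
    rw [map_zero, add_zero, mul_assoc, hcomm]
    simp [sub_eq_add_neg]
  have h3 := norm_image_sub_le_of_norm_deriv_le_segment' (a := 0) (b := t) (C := ‖B h - C h‖)
    (fun s _ => (hd s).hasDerivWithinAt) (fun s hs => by
      refine (norm_exp_apply_le hB hs.1 _).trans (norm_exp_apply_le hC ?_ _)
      linarith [hs.2]) t ⟨ht, le_refl t⟩
  simpa [mul_comm] using h3

end DissipativeRelation

/-! ### The Hille–Yosida theorem -/

namespace DissipativeRelation

variable {H : Type*} [NormedAddCommGroup H] [InnerProductSpace ℝ H]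
  {A : Submodule ℝ (H × H)}

theorem tendsto_resolvent (hA : IsMDissipative A) (hd : Dense (Prod.fst '' (A : Set (H × H))))
    (h : H) : Tendsto (fun n : ℕ => resolvent hA (Nat.one_div_pos_of_nat (α := ℝ) (n := n)) h)
      atTop (𝓝 h) := by
  rw [Metric.tendsto_atTop]
  intro ε hε
  obtain ⟨_, ⟨p, hp, rfl⟩, hpd⟩ := hd.exists_dist_lt h (ε := ε / 3) (by positivity)
  have h0 : Tendsto (fun n : ℕ => 1 / ((n : ℝ) + 1) * ‖p.2‖) atTop (𝓝 0) := by
    simpa using (tendsto_one_div_add_atTop_nhds_zero_nat (𝕜 := ℝ)).mul_const ‖p.2‖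
  obtain ⟨N, hN⟩ := (Metric.tendsto_atTop.1 h0) (ε / 3) (by positivity)
  refine ⟨N, fun n hn => ?_⟩
  set hc := Nat.one_div_pos_of_nat (α := ℝ) (n := n)
  have h1 : ‖resolvent hA hc p.1 - p.1‖ < ε / 3 := by
    rw [← yosida_eq, norm_smul]
    have h2 := hN n hn
    rw [Real.dist_eq, sub_zero] at h2
    refine lt_of_le_of_lt ?_ (lt_of_le_of_lt (le_abs_self _) h2)
    rw [Real.norm_of_nonneg hc.le]
    exact mul_le_mul_of_nonneg_left (norm_yosida_le hA hc hp) hc.le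
  have h2 : ‖resolvent hA hc (h - p.1)‖ < ε / 3 :=
    (norm_resolvent_apply_le hA hc _).trans_lt (by rwa [← dist_eq_norm])
  rw [dist_eq_norm] at hpd ⊢
  have h3 : resolvent hA hc h - h =
      resolvent hA hc (h - p.1) + (resolvent hA hc p.1 - p.1) - (h - p.1) := by
    rw [map_sub]; abel
  rw [h3]
  linarith [norm_sub_le (resolvent hA hc (h - p.1) + (resolvent hA hc p.1 - p.1)) (h - p.1),
    norm_add_le (resolvent hA hc (h - p.1)) (resolvent hA hc p.1 - p.1)]

theorem tendsto_yosida (hA : IsMDissipative A) (hd : Dense (Prod.fst '' (A : Set (H × H))))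
    {p : H × H} (hp : p ∈ A) :
    Tendsto (fun n : ℕ => yosida hA (Nat.one_div_pos_of_nat (α := ℝ) (n := n)) p.1)
      atTop (𝓝 p.2) :=
  (tendsto_resolvent hA hd p.2).congr fun _ => resolvent_snd hA _ hp

variable [CompleteSpace H]

/-- The semigroup at time `t` of the Yosida approximation with parameter `c = 1 / (n + 1)`. -/
noncomputable def approx (hA : IsMDissipative A) (n : ℕ) (t : ℝ≥0) : H →L[ℝ] H :=
  NormedSpace.exp ((t : ℝ) • yosida hA (Nat.one_div_pos_of_nat (α := ℝ) (n := n)))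

theorem norm_approx_le (hA : IsMDissipative A) (n : ℕ) (t : ℝ≥0) (h : H) :
    ‖approx hA n t h‖ ≤ ‖h‖ :=
  norm_exp_apply_le (inner_yosida_nonpos hA _) t.2 h

theorem cauchySeq_approx (hA : IsMDissipative A) (hd : Dense (Prod.fst '' (A : Set (H × H))))
    (t : ℝ≥0) (h : H) : CauchySeq fun n => approx hA n t h := by
  rw [Metric.cauchySeq_iff]
  intro ε hε
  obtain ⟨_, ⟨p, hp, rfl⟩, hpd⟩ := hd.exists_dist_lt h (ε := ε / 3) (by positivity)
  have h0 : CauchySeq fun n : ℕ =>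
      (t : ℝ) • yosida hA (Nat.one_div_pos_of_nat (α := ℝ) (n := n)) p.1 :=
    ((tendsto_yosida hA hd hp).const_smul (t : ℝ)).cauchySeq
  obtain ⟨N, hN⟩ := (Metric.cauchySeq_iff.1 h0) (ε / 3) (by positivity)
  refine ⟨N, fun i hi j hj => ?_⟩
  have h1 := hN i hi j hj
  rw [dist_eq_norm, ← smul_sub, norm_smul, Real.norm_of_nonneg (NNReal.coe_nonneg t)] at h1
  have h2 : ‖approx hA i t p.1 - approx hA j t p.1‖ < ε / 3 :=
    (norm_exp_apply_sub_le (commute_yosida hA _ _) (inner_yosida_nonpos hA _)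
      (inner_yosida_nonpos hA _) t.2 p.1).trans_lt h1
  have h3 := norm_approx_le hA i t (h - p.1)
  have h4 := norm_approx_le hA j t (h - p.1)
  rw [dist_eq_norm] at hpd ⊢
  have h5 : approx hA i t h - approx hA j t h = approx hA i t (h - p.1) +
      (approx hA i t p.1 - approx hA j t p.1) - approx hA j t (h - p.1) := by
    rw [map_sub, map_sub]; abel
  rw [h5]
  linarith [norm_sub_le (approx hA i t (h - p.1) + (approx hA i t p.1 - approx hA j t p.1))
    (approx hA j t (h - p.1)),
    norm_add_le (approx hA i t (h - p.1)) (approx hA i t p.1 - approx hA j t p.1)]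

/-- The limit of the Yosida semigroups. -/
noncomputable def limitFun (hA : IsMDissipative A) (hd : Dense (Prod.fst '' (A : Set (H × H))))
    (t : ℝ≥0) (h : H) : H :=
  (cauchySeq_tendsto_of_complete (cauchySeq_approx hA hd t h)).choose

theorem tendsto_approx (hA : IsMDissipative A) (hd : Dense (Prod.fst '' (A : Set (H × H))))
    (t : ℝ≥0) (h : H) : Tendsto (fun n => approx hA n t h) atTop (𝓝 (limitFun hA hd t h)) :=
  (cauchySeq_tendsto_of_complete (cauchySeq_approx hA hd t h)).choose_spec

theorem norm_limitFun_le (hA : IsMDissipative A) (hd : Dense (Prod.fst '' (A : Set (H × H))))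
    (t : ℝ≥0) (h : H) : ‖limitFun hA hd t h‖ ≤ ‖h‖ :=
  le_of_tendsto (tendsto_approx hA hd t h).norm
    (Eventually.of_forall fun n => norm_approx_le hA n t h)

/-- The limit of the Yosida semigroups, as a contraction. -/
noncomputable def limitOp (hA : IsMDissipative A) (hd : Dense (Prod.fst '' (A : Set (H × H))))
    (t : ℝ≥0) : H →L[ℝ] H :=
  LinearMap.mkContinuous
    { toFun := limitFun hA hd t
      map_add' := fun x y => tendsto_nhds_unique (tendsto_approx hA hd t (x + y)) <| by
        simpa only [map_add] using (tendsto_approx hA hd t x).add (tendsto_approx hA hd t y)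
      map_smul' := fun a x => tendsto_nhds_unique (tendsto_approx hA hd t (a • x)) <| by
        simpa only [map_smul, RingHom.id_apply] using (tendsto_approx hA hd t x).const_smul a }
    1 fun h => by simpa using norm_limitFun_le hA hd t h

theorem norm_limitOp_le (hA : IsMDissipative A) (hd : Dense (Prod.fst '' (A : Set (H × H))))
    (t : ℝ≥0) (h : H) : ‖limitOp hA hd t h‖ ≤ ‖h‖ := norm_limitFun_le hA hd t h

theorem tendsto_approx_limitOp (hA : IsMDissipative A)
    (hd : Dense (Prod.fst '' (A : Set (H × H)))) (t : ℝ≥0) (h : H) :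
    Tendsto (fun n => approx hA n t h) atTop (𝓝 (limitOp hA hd t h)) :=
  tendsto_approx hA hd t h

theorem limitOp_zero (hA : IsMDissipative A) (hd : Dense (Prod.fst '' (A : Set (H × H)))) :
    limitOp hA hd 0 = ContinuousLinearMap.id ℝ H := by
  ext h
  refine tendsto_nhds_unique (tendsto_approx_limitOp hA hd 0 h) ?_
  simp [approx, NormedSpace.exp_zero]

theorem approx_add (hA : IsMDissipative A) (n : ℕ) (s t : ℝ≥0) (h : H) :
    approx hA n (s + t) h = approx hA n s (approx hA n t h) := by
  let : NormedAlgebra ℚ (H →L[ℝ] H) := NormedAlgebra.restrictScalars ℚ ℝ (H →L[ℝ] H)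
  unfold approx
  rw [NNReal.coe_add, add_smul, NormedSpace.exp_add_of_commute]
  · rfl
  · exact ((Commute.refl _).smul_left _).smul_right _

theorem limitOp_add (hA : IsMDissipative A) (hd : Dense (Prod.fst '' (A : Set (H × H))))
    (s t : ℝ≥0) : limitOp hA hd (s + t) = (limitOp hA hd s).comp (limitOp hA hd t) := by
  ext h
  refine tendsto_nhds_unique (tendsto_approx_limitOp hA hd (s + t) h) ?_
  have h1 : Tendsto (fun n => approx hA n s (approx hA n t h - limitOp hA hd t h)) atTop (𝓝 0) := by
    refine squeeze_zero_norm (fun n => norm_approx_le hA n s _) ?_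
    exact tendsto_iff_norm_sub_tendsto_zero.1 (tendsto_approx_limitOp hA hd t h)
  have h2 := h1.add (tendsto_approx_limitOp hA hd s (limitOp hA hd t h))
  rw [zero_add] at h2
  refine h2.congr fun n => ?_
  rw [approx_add, map_sub, sub_add_cancel]

theorem norm_limitOp_sub_self_le_of_mem (hA : IsMDissipative A)
    (hd : Dense (Prod.fst '' (A : Set (H × H)))) (t : ℝ≥0) {p : H × H} (hp : p ∈ A) :
    ‖limitOp hA hd t p.1 - p.1‖ ≤ t * ‖p.2‖ := by
  refine le_of_tendsto ((tendsto_approx_limitOp hA hd t p.1).sub_const p.1).norm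
    (Eventually.of_forall fun n => ?_)
  -- comparison with the constant semigroup, generated by `0`
  have h1 := norm_exp_apply_sub_le (Commute.zero_right
    (yosida hA (Nat.one_div_pos_of_nat (α := ℝ) (n := n))))
    (inner_yosida_nonpos hA _) (fun h => by simp) t.2 p.1
  simp only [smul_zero, NormedSpace.exp_zero, one_apply_eq_self,
    zero_apply, sub_zero] at h1
  exact h1.trans (mul_le_mul_of_nonneg_left (norm_yosida_le hA _ hp) t.2)

/-- Strong continuity at `0`, quantified through an approximation of `h` in the domain. -/
theorem norm_limitOp_sub_self_le (hA : IsMDissipative A)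
    (hd : Dense (Prod.fst '' (A : Set (H × H)))) (t : ℝ≥0) {p : H × H} (hp : p ∈ A) (h : H) :
    ‖limitOp hA hd t h - h‖ ≤ t * ‖p.2‖ + 2 * ‖h - p.1‖ := by
  have h1 := norm_limitOp_sub_self_le_of_mem hA hd t hp
  have h2 := norm_limitOp_le hA hd t (h - p.1)
  have h3 : limitOp hA hd t h - h =
      (limitOp hA hd t p.1 - p.1) + limitOp hA hd t (h - p.1) - (h - p.1) := by
    rw [map_sub]; abel
  rw [h3]
  linarith [norm_sub_le ((limitOp hA hd t p.1 - p.1) + limitOp hA hd t (h - p.1)) (h - p.1),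
    norm_add_le (limitOp hA hd t p.1 - p.1) (limitOp hA hd t (h - p.1))]

theorem tendsto_limitOp_zero (hA : IsMDissipative A)
    (hd : Dense (Prod.fst '' (A : Set (H × H)))) (h : H) :
    Tendsto (fun t => limitOp hA hd t h) (𝓝 0) (𝓝 h) := by
  rw [Metric.tendsto_nhds]
  intro ε hε
  obtain ⟨_, ⟨p, hp, rfl⟩, hpd⟩ := hd.exists_dist_lt h (ε := ε / 3) (by positivity)
  have h1 : Tendsto (fun t : ℝ≥0 => (t : ℝ) * ‖p.2‖) (𝓝 0) (𝓝 0) := by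
    have : Continuous fun t : ℝ≥0 => (t : ℝ) * ‖p.2‖ := by fun_prop
    simpa using this.tendsto 0
  filter_upwards [h1.eventually_lt_const (show (0 : ℝ) < ε / 3 by positivity)] with t ht
  rw [dist_eq_norm] at hpd ⊢
  linarith [norm_limitOp_sub_self_le hA hd t hp h]

theorem continuous_limitOp (hA : IsMDissipative A)
    (hd : Dense (Prod.fst '' (A : Set (H × H)))) (h : H) :
    Continuous fun t => limitOp hA hd t h := by
  have key : ∀ s t : ℝ≥0, s ≤ t →
      dist (limitOp hA hd t h) (limitOp hA hd s h) ≤ ‖limitOp hA hd (t - s) h - h‖ := by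
    intro s t hst
    have h1 : limitOp hA hd t h = limitOp hA hd s (limitOp hA hd (t - s) h) := by
      conv_lhs => rw [← add_tsub_cancel_of_le hst, limitOp_add]
      rfl
    rw [dist_eq_norm, h1, ← map_sub]
    exact norm_limitOp_le hA hd s _
  rw [continuous_iff_continuousAt]
  intro s
  rw [ContinuousAt, tendsto_iff_dist_tendsto_zero]
  have h2 : Tendsto (fun t : ℝ≥0 => ‖limitOp hA hd (t - s) h - h‖ + ‖limitOp hA hd (s - t) h - h‖)
      (𝓝 s) (𝓝 0) := by
    have h3 : Tendsto (fun t : ℝ≥0 => t - s) (𝓝 s) (𝓝 0) := by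
      have : Continuous fun t : ℝ≥0 => t - s := by fun_prop
      simpa using this.tendsto s
    have h4 : Tendsto (fun t : ℝ≥0 => s - t) (𝓝 s) (𝓝 0) := by
      have : Continuous fun t : ℝ≥0 => s - t := by fun_prop
      simpa using this.tendsto s
    have h5 := tendsto_iff_norm_sub_tendsto_zero.1 ((tendsto_limitOp_zero hA hd h).comp h3)
    have h6 := tendsto_iff_norm_sub_tendsto_zero.1 ((tendsto_limitOp_zero hA hd h).comp h4)
    simpa using h5.add h6
  refine squeeze_zero (fun _ => dist_nonneg) (fun t => ?_) h2
  rcases le_total s t with hst | hst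
  · exact (key s t hst).trans (le_add_of_nonneg_right (norm_nonneg _))
  · rw [dist_comm]
    exact (key t s hst).trans (le_add_of_nonneg_left (norm_nonneg _))

/-- The semigroup obtained as the limit of the Yosida semigroups. -/
noncomputable def limitSemigroup (hA : IsMDissipative A)
    (hd : Dense (Prod.fst '' (A : Set (H × H)))) : C0Semigroup H where
  op := limitOp hA hd
  op_zero := limitOp_zero hA hd
  op_add := limitOp_add hA hd
  continuous_orbit := continuous_limitOp hA hd

/-- First order expansion of the Yosida semigroup at `t = 0`, for `p = (f, A f)`. The error is
controlled by an element `q.1` of the domain close to `A f`, uniformly in the approximation. -/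
theorem norm_approx_sub_sub_le (hA : IsMDissipative A) (n : ℕ) (t : ℝ≥0) {p q : H × H}
    (hq : q ∈ A) :
    ‖approx hA n t p.1 - p.1 - (t : ℝ) • p.2‖ ≤
      (‖yosida hA (Nat.one_div_pos_of_nat (α := ℝ) (n := n)) p.1 - p.2‖ +
        (t * ‖q.2‖ + 2 * ‖p.2 - q.1‖)) * t := by
  set B := yosida hA (Nat.one_div_pos_of_nat (α := ℝ) (n := n)) with hB
  have hdis : ∀ h, inner ℝ (B h) h ≤ 0 := inner_yosida_nonpos hA _
  have hd : ∀ s : ℝ, HasDerivAt (fun s : ℝ => NormedSpace.exp (s • B) p.1 - s • p.2)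
      (NormedSpace.exp (s • B) (B p.1) - p.2) s := by
    intro s
    refine (hasDerivAt_exp_apply B p.1 s).sub ?_
    simpa using (hasDerivAt_id s).smul_const p.2
  have h3 := norm_image_sub_le_of_norm_deriv_le_segment' (a := 0) (b := (t : ℝ))
    (C := ‖B p.1 - p.2‖ + (t * ‖q.2‖ + 2 * ‖p.2 - q.1‖))
    (fun s _ => (hd s).hasDerivWithinAt) (fun s hs => ?_) t ⟨t.2, le_refl _⟩
  · unfold approx
    rw [← hB]
    simpa [NormedSpace.exp_zero, sub_right_comm] using h3
  · have h4 : ‖NormedSpace.exp (s • B) q.1 - q.1‖ ≤ t * ‖q.2‖ := by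
      have h1 := norm_exp_apply_sub_le (Commute.zero_right B) hdis (fun h => by simp) hs.1 q.1
      simp only [smul_zero, NormedSpace.exp_zero, one_apply_eq_self, zero_apply, sub_zero] at h1
      refine h1.trans (mul_le_mul hs.2.le (norm_yosida_le hA _ hq) (norm_nonneg _) t.2)
    have h5 := norm_exp_apply_le hdis hs.1 (B p.1 - p.2)
    have h6 := norm_exp_apply_le hdis hs.1 (p.2 - q.1)
    have h7 : NormedSpace.exp (s • B) (B p.1) - p.2 = NormedSpace.exp (s • B) (B p.1 - p.2) +
        ((NormedSpace.exp (s • B) q.1 - q.1) + NormedSpace.exp (s • B) (p.2 - q.1)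
          - (p.2 - q.1)) := by
      rw [map_sub, map_sub]; abel
    rw [h7]
    refine (norm_add_le _ _).trans (add_le_add h5 ?_)
    linarith [norm_sub_le ((NormedSpace.exp (s • B) q.1 - q.1) +
      NormedSpace.exp (s • B) (p.2 - q.1)) (p.2 - q.1),
      norm_add_le (NormedSpace.exp (s • B) q.1 - q.1) (NormedSpace.exp (s • B) (p.2 - q.1))]

theorem norm_limitOp_sub_sub_le (hA : IsMDissipative A)
    (hd : Dense (Prod.fst '' (A : Set (H × H)))) (t : ℝ≥0) {p q : H × H} (hp : p ∈ A)
    (hq : q ∈ A) :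
    ‖limitOp hA hd t p.1 - p.1 - (t : ℝ) • p.2‖ ≤ (t * ‖q.2‖ + 2 * ‖p.2 - q.1‖) * t := by
  have h1 := (((tendsto_approx_limitOp hA hd t p.1).sub_const p.1).sub_const ((t : ℝ) • p.2)).norm
  have h2 := tendsto_iff_norm_sub_tendsto_zero.1 (tendsto_yosida hA hd hp)
  have h3 := (h2.add_const (t * ‖q.2‖ + 2 * ‖p.2 - q.1‖)).mul_const (t : ℝ)
  rw [zero_add] at h3
  exact le_of_tendsto_of_tendsto' h1 h3 fun n => norm_approx_sub_sub_le hA n t hq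

theorem tendsto_slope_of_mem (hA : IsMDissipative A)
    (hd : Dense (Prod.fst '' (A : Set (H × H)))) {p : H × H} (hp : p ∈ A) :
    Tendsto (fun t : ℝ≥0 => (t : ℝ)⁻¹ • (limitOp hA hd t p.1 - p.1)) (𝓝[>] 0) (𝓝 p.2) := by
  rw [Metric.tendsto_nhds]
  intro ε hε
  obtain ⟨_, ⟨q, hq, rfl⟩, hqd⟩ := hd.exists_dist_lt p.2 (ε := ε / 3) (by positivity)
  have h1 : Tendsto (fun t : ℝ≥0 => (t : ℝ) * ‖q.2‖) (𝓝[>] 0) (𝓝 0) := by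
    have : Continuous fun t : ℝ≥0 => (t : ℝ) * ‖q.2‖ := by fun_prop
    simpa using (this.tendsto 0).mono_left nhdsWithin_le_nhds
  filter_upwards [h1.eventually_lt_const (show (0 : ℝ) < ε / 3 by positivity),
    self_mem_nhdsWithin] with t ht ht0
  have ht0' : (0 : ℝ) < t := ht0
  rw [dist_eq_norm] at hqd ⊢
  have h2 := norm_limitOp_sub_sub_le hA hd t hp hq
  have h3 : (t : ℝ)⁻¹ • (limitOp hA hd t p.1 - p.1) - p.2 =
      (t : ℝ)⁻¹ • (limitOp hA hd t p.1 - p.1 - (t : ℝ) • p.2) := by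
    rw [smul_sub _ _ ((t : ℝ) • p.2), inv_smul_smul₀ ht0'.ne']
  rw [h3, norm_smul, norm_inv, Real.norm_of_nonneg ht0'.le, inv_mul_lt_iff₀ ht0']
  refine h2.trans_lt ?_
  rw [mul_comm]
  exact mul_lt_mul_of_pos_left (by linarith) ht0'

/-- **Hille–Yosida** in a Hilbert space: a single-valued m-dissipative operator generates a
strongly continuous semigroup. -/
theorem exists_hasGenerator (hA : IsMDissipative A) (hs : ∀ g, ((0 : H), g) ∈ A → g = 0) :
    ∃ T : C0Semigroup H, T.HasGenerator (A : Set (H × H)) := by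
  have hd := dense_domain hA hs
  refine ⟨limitSemigroup hA hd, fun f g => ⟨fun h => tendsto_slope_of_mem hA hd (p := (f, g)) h,
    fun h => ?_⟩⟩
  obtain ⟨p, hp, hpe⟩ := hA.exists_resolvent 1 one_pos (f - g)
  rw [one_smul] at hpe
  have h1 := h.sub (tendsto_slope_of_mem hA hd hp)
  -- `z = f - p.1` satisfies `A z = z` for the generator, so that `z = 0` by contractivity.
  have hz : g - p.2 = f - p.1 := by
    have h2 : g - p.2 = f - (f - g) - p.2 := by abel
    rw [h2, ← hpe]; abel
  have h2 : inner ℝ (g - p.2) (f - p.1) ≤ 0 := by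
    refine le_of_tendsto (h1.inner tendsto_const_nhds) (Eventually.of_forall fun t => ?_)
    change inner ℝ ((t : ℝ)⁻¹ • (limitOp hA hd t f - f) - (t : ℝ)⁻¹ • (limitOp hA hd t p.1 - p.1))
      (f - p.1) ≤ 0
    rw [← smul_sub, sub_sub_sub_comm, ← map_sub, inner_smul_left, inner_sub_left,
      real_inner_self_eq_norm_mul_norm]
    refine mul_nonpos_of_nonneg_of_nonpos (by simp) ?_
    have h3 := real_inner_le_norm (limitOp hA hd t (f - p.1)) (f - p.1)
    have h4 := mul_le_mul_of_nonneg_right (norm_limitOp_le hA hd t (f - p.1))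
      (norm_nonneg (f - p.1))
    linarith
  rw [hz, real_inner_self_nonpos, sub_eq_zero] at h2
  rw [h2, sub_self, sub_eq_zero] at hz
  have : (f, g) = p := Prod.ext h2 hz
  rw [this]
  exact hp

end DissipativeRelation

/-! ### Orbits of a semigroup and its generator -/

namespace C0Semigroup

variable {X : Type*} [NormedAddCommGroup X] [NormedSpace ℝ X] (T : C0Semigroup X)

/-- The orbit `s ↦ T_s f`, extended to `s < 0` by the constant `f`. -/
noncomputable def orbit (f : X) (s : ℝ) : X := T.op s.toNNReal f

theorem orbit_coe (f : X) (t : ℝ≥0) : T.orbit f t = T.op t f := by simp [orbit]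

theorem orbit_zero (f : X) : T.orbit f 0 = f := by simp [orbit, T.op_zero]

theorem continuous_orbit' (f : X) : Continuous (T.orbit f) :=
  (T.continuous_orbit f).comp continuous_real_toNNReal

theorem orbit_sub (f g : X) (s : ℝ) : T.orbit (f - g) s = T.orbit f s - T.orbit g s :=
  map_sub _ _ _

variable {T} {A : Set (X × X)}

/-- The semigroup preserves the domain of its generator and commutes with the generator. -/
theorem HasGenerator.op_mem (hT : T.HasGenerator A) {f g : X} (h : (f, g) ∈ A) (t : ℝ≥0) :
    (T.op t f, T.op t g) ∈ A := by
  rw [hT] at h ⊢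
  have h1 := ((T.op t).continuous.tendsto g).comp h
  refine h1.congr fun s => ?_
  have h2 : T.op t (T.op s f) = T.op s (T.op t f) := by
    rw [← ContinuousLinearMap.comp_apply, ← T.op_add, add_comm, T.op_add,
      ContinuousLinearMap.comp_apply]
  simp only [Function.comp_apply, map_smul, map_sub, h2]

theorem HasGenerator.orbit_mem (hT : T.HasGenerator A) {f g : X} (h : (f, g) ∈ A) (s : ℝ) :
    (T.orbit f s, T.orbit g s) ∈ A := hT.op_mem h _

theorem HasGenerator.hasDerivWithinAt_orbit (hT : T.HasGenerator A) {f g : X} (h : (f, g) ∈ A)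
    {s : ℝ} (hs : 0 ≤ s) : HasDerivWithinAt (T.orbit f) (T.orbit g s) (Set.Ici s) s := by
  rw [← hasDerivWithinAt_Ioi_iff_Ici, hasDerivWithinAt_iff_tendsto_slope' (by simp)]
  have h1 := (hT _ _).1 (hT.orbit_mem h s)
  have h2 : Tendsto (fun r : ℝ => (r - s).toNNReal) (𝓝[>] s) (𝓝[>] 0) := by
    refine tendsto_nhdsWithin_iff.2 ⟨?_, ?_⟩
    · have : Continuous fun r : ℝ => (r - s).toNNReal := by fun_prop
      simpa using (this.tendsto s).mono_left nhdsWithin_le_nhds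
    · filter_upwards [self_mem_nhdsWithin] with r hr
      simpa using hr
  refine (h1.comp h2).congr' ?_
  filter_upwards [self_mem_nhdsWithin] with r hr
  have hr' : s < r := hr
  have h3 : T.orbit f r = T.op (r - s).toNNReal (T.orbit f s) := by
    unfold orbit
    rw [← ContinuousLinearMap.comp_apply, ← T.op_add, ← Real.toNNReal_add (by linarith) hs,
      sub_add_cancel]
  rw [Function.comp_apply, slope_def_module, h3, Real.coe_toNNReal _ (by linarith)]

/-- The orbit of an element of the domain is the integral of its right derivative, so that it is
differentiable from both sides. -/
theorem HasGenerator.hasDerivAt_orbit [CompleteSpace X] (hT : T.HasGenerator A) {f g : X}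
    (h : (f, g) ∈ A) {s : ℝ} (hs : 0 < s) : HasDerivAt (T.orbit f) (T.orbit g s) s := by
  have hi : ∀ r : ℝ, HasDerivAt (fun r => ∫ x in (0 : ℝ)..r, T.orbit g x) (T.orbit g r) r :=
    fun r => ((T.continuous_orbit' g).integral_hasStrictDerivAt 0 r).hasDerivAt
  have h1 : ∀ r, 0 ≤ r → T.orbit f r - ∫ x in (0 : ℝ)..r, T.orbit g x = f := by
    intro r hr
    have h2 := constant_of_has_deriv_right_zero
      (f := fun r => T.orbit f r - ∫ x in (0 : ℝ)..r, T.orbit g x) (a := 0) (b := r)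
      ((T.continuous_orbit' f).sub (continuous_iff_continuousAt.2
        fun x => (hi x).continuousAt)).continuousOn (fun x hx => by
        exact ((hT.hasDerivWithinAt_orbit h hx.1).sub
          (hi x).hasDerivWithinAt).congr_deriv (sub_self _)) r
      ⟨hr, le_refl r⟩
    simpa [orbit_zero] using h2
  have h3 : HasDerivAt (fun r => f + ∫ x in (0 : ℝ)..r, T.orbit g x) (T.orbit g s) s :=
    (hi s).const_add f
  refine h3.congr_of_eventuallyEq ?_
  filter_upwards [Ioi_mem_nhds hs] with r hr
  exact sub_eq_iff_eq_add.1 (h1 r (le_of_lt hr))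

end C0Semigroup

/-! ### Gradient forms, energy and Green's formula -/

namespace WeightedGraph

variable {V : Type*} (G : WeightedGraph V)

theorem mem_nbrs {x y : V} : y ∈ G.nbrs x ↔ 0 < G.μ x y := by simp [nbrs]

theorem hasSum_nbrs {x : V} {F : V → ℝ} (hF : ∀ y, G.μ x y = 0 → F y = 0) :
    HasSum F (∑ y ∈ G.nbrs x, F y) := by
  refine hasSum_sum_of_ne_finset_zero fun y hy => hF y ?_
  rw [mem_nbrs, not_lt] at hy
  exact le_antisymm hy (G.μ_nonneg x y)

theorem m_mul_lap (f : V → ℝ) (x : V) :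
    G.m x * G.lap f x = ∑ y ∈ G.nbrs x, G.μ x y * (f y - f x) := by
  rw [lap, mul_inv_cancel_left₀ (G.m_pos x).ne']

theorem gammaForm_eq (f g : V → ℝ) (x : V) :
    G.gammaForm f g x =
      (G.m x)⁻¹ * ∑ y ∈ G.nbrs x, G.μ x y * (f y - f x) * (g y - g x) / 2 := by
  unfold gammaForm lap
  rw [mul_left_comm (f x), mul_left_comm (g x), ← mul_sub, ← mul_sub, mul_div_assoc,
    Finset.mul_sum, Finset.mul_sum, ← Finset.sum_sub_distrib, ← Finset.sum_sub_distrib,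
    Finset.sum_div]
  congr 1
  refine Finset.sum_congr rfl fun y _ => ?_
  simp only [Pi.mul_apply]
  ring

theorem m_mul_gammaForm (f g : V → ℝ) (x : V) :
    G.m x * G.gammaForm f g x = ∑ y ∈ G.nbrs x, G.μ x y * (f y - f x) * (g y - g x) / 2 := by
  rw [gammaForm_eq, mul_inv_cancel_left₀ (G.m_pos x).ne']

theorem gammaForm_comm (f g : V → ℝ) (x : V) : G.gammaForm f g x = G.gammaForm g f x := by
  simp only [gammaForm_eq, mul_right_comm]

theorem gammaForm_add_left (f f' g : V → ℝ) (x : V) :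
    G.gammaForm (f + f') g x = G.gammaForm f g x + G.gammaForm f' g x := by
  simp only [gammaForm_eq, ← mul_add, ← Finset.sum_add_distrib, Pi.add_apply]
  congr 1
  exact Finset.sum_congr rfl fun y _ => by ring

theorem gammaForm_sub_left (f f' g : V → ℝ) (x : V) :
    G.gammaForm (f - f') g x = G.gammaForm f g x - G.gammaForm f' g x := by
  simp only [gammaForm_eq, ← mul_sub, ← Finset.sum_sub_distrib, Pi.sub_apply]
  congr 1
  exact Finset.sum_congr rfl fun y _ => by ring

theorem gammaForm_add_right (f g g' : V → ℝ) (x : V) :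
    G.gammaForm f (g + g') x = G.gammaForm f g x + G.gammaForm f g' x := by
  rw [gammaForm_comm, gammaForm_add_left, G.gammaForm_comm g, G.gammaForm_comm g']

theorem gammaForm_sub_right (f g g' : V → ℝ) (x : V) :
    G.gammaForm f (g - g') x = G.gammaForm f g x - G.gammaForm f g' x := by
  rw [gammaForm_comm, gammaForm_sub_left, G.gammaForm_comm g, G.gammaForm_comm g']

theorem gamma_nonneg (f : V → ℝ) (x : V) : 0 ≤ G.gamma f x := by
  rw [gamma, gammaForm_eq]
  refine mul_nonneg (inv_nonneg.2 (G.m_pos x).le) (Finset.sum_nonneg fun y _ => ?_)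
  rw [mul_assoc]
  exact div_nonneg (mul_nonneg (G.μ_nonneg x y) (mul_self_nonneg _)) zero_le_two

/-- `Γ` does not increase under a normal contraction. -/
theorem gamma_le_gamma_of_abs_sub_le {f g : V → ℝ} (h : ∀ x y, |f y - f x| ≤ |g y - g x|) (x : V) :
    G.gamma f x ≤ G.gamma g x := by
  rw [gamma, gamma, gammaForm_eq, gammaForm_eq]
  refine mul_le_mul_of_nonneg_left (Finset.sum_le_sum fun y _ => ?_) (inv_nonneg.2 (G.m_pos x).le)
  have h1 := mul_le_mul_of_nonneg_left (sq_le_sq.2 (h x y)) (G.μ_nonneg x y)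
  nlinarith

theorem finite_edges {S : Set V} (hS : S.Finite) :
    {p : V × V | 0 < G.μ p.1 p.2 ∧ (p.1 ∈ S ∨ p.2 ∈ S)}.Finite := by
  have h1 : (⋃ x ∈ S, (fun y => (x, y)) '' {y | 0 < G.μ x y}).Finite :=
    hS.biUnion fun x _ => (G.locallyFinite x).image _
  refine (h1.union (h1.image Prod.swap)).subset ?_
  rintro ⟨x, y⟩ ⟨hp, hx | hy⟩
  · left
    simp only [Set.mem_iUnion]
    exact ⟨x, hx, y, hp, rfl⟩
  · right
    refine ⟨(y, x), ?_, rfl⟩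
    simp only [Set.mem_iUnion]
    exact ⟨y, hy, x, by rwa [Set.mem_ofPred_eq, G.μ_symm], rfl⟩

/-- A function on pairs that vanishes off the edges with an endpoint in a finite set is summable. -/
theorem summable_of_finite {S : Set V} (hS : S.Finite) {F : V × V → ℝ}
    (hF : ∀ p, F p ≠ 0 → G.μ p.1 p.2 ≠ 0 ∧ (p.1 ∈ S ∨ p.2 ∈ S)) : Summable F := by
  refine summable_of_hasFiniteSupport ((G.finite_edges hS).subset fun p hp => ?_)
  exact ⟨lt_of_le_of_ne (G.μ_nonneg _ _) (Ne.symm (hF p hp).1), (hF p hp).2⟩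

theorem finite_nbhd {S : Set V} (hS : S.Finite) :
    (S ∪ {x | ∃ y ∈ S, 0 < G.μ x y}).Finite := by
  refine hS.union (((G.finite_edges hS).image Prod.fst).subset ?_)
  rintro x ⟨y, hy, hxy⟩
  exact ⟨(x, y), ⟨hxy, Or.inr hy⟩, rfl⟩

theorem finite_support_lap {f : V → ℝ} (hf : (Function.support f).Finite) :
    (Function.support (G.lap f)).Finite := by
  refine (G.finite_nbhd hf).subset fun x hx => ?_
  by_contra hn
  simp only [Set.mem_union, Function.mem_support, Set.mem_ofPred_eq, not_or, not_not, not_exists,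
    not_and] at hn
  refine hx ?_
  rw [lap, Finset.sum_eq_zero, mul_zero]
  intro y hy
  have h1 : f y = 0 := by
    by_contra hfy
    exact hn.2 y hfy (G.mem_nbrs.1 hy)
  rw [h1, hn.1, sub_zero, mul_zero]

theorem finite_support_gamma {f : V → ℝ} (hf : (Function.support f).Finite) :
    (Function.support (G.gamma f)).Finite := by
  refine (G.finite_nbhd hf).subset fun x hx => ?_
  by_contra hn
  simp only [Set.mem_union, Function.mem_support, Set.mem_ofPred_eq, not_or, not_not, not_exists,
    not_and] at hn
  refine hx ?_
  rw [gamma, gammaForm_eq, Finset.sum_eq_zero, mul_zero]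
  intro y hy
  have h1 : f y = 0 := by
    by_contra hfy
    exact hn.2 y hfy (G.mem_nbrs.1 hy)
  rw [h1, hn.1]
  ring

variable {G}

theorem FiniteEnergy.summable_mul {f g : V → ℝ} (hf : G.FiniteEnergy f) (hg : G.FiniteEnergy g) :
    Summable fun p : V × V => G.μ p.1 p.2 * (f p.2 - f p.1) * (g p.2 - g p.1) := by
  refine Summable.of_norm_bounded (Summable.add hf hg) fun p => ?_
  rw [mul_assoc, norm_mul, Real.norm_of_nonneg (G.μ_nonneg _ _), ← mul_add, Real.norm_eq_abs]
  refine mul_le_mul_of_nonneg_left ?_ (G.μ_nonneg _ _)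
  rw [abs_le]
  constructor <;> nlinarith [sq_nonneg (f p.2 - f p.1 + (g p.2 - g p.1)),
    sq_nonneg (f p.2 - f p.1 - (g p.2 - g p.1))]

theorem FiniteEnergy.add {f g : V → ℝ} (hf : G.FiniteEnergy f) (hg : G.FiniteEnergy g) :
    G.FiniteEnergy (f + g) := by
  have h := (Summable.add hf hg).add ((hf.summable_mul hg).mul_left 2)
  refine h.congr fun p => ?_
  simp only [Pi.add_apply]
  ring

theorem FiniteEnergy.const_smul {f : V → ℝ} (hf : G.FiniteEnergy f) (c : ℝ) :
    G.FiniteEnergy (c • f) := by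
  have h := Summable.mul_left (c ^ 2) hf
  refine h.congr fun p => ?_
  simp only [Pi.smul_apply, smul_eq_mul]
  ring

theorem FiniteEnergy.sub {f g : V → ℝ} (hf : G.FiniteEnergy f) (hg : G.FiniteEnergy g) :
    G.FiniteEnergy (f - g) := by
  have h : f - g = f + (-1 : ℝ) • g := by simp [sub_eq_add_neg]
  rw [h]
  exact hf.add (hg.const_smul _)

theorem FiniteEnergy.of_abs_sub_le {f g : V → ℝ} (hg : G.FiniteEnergy g)
    (h : ∀ x y, |f y - f x| ≤ |g y - g x|) : G.FiniteEnergy f :=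
  Summable.of_nonneg_of_le (fun _ => mul_nonneg (G.μ_nonneg _ _) (sq_nonneg _))
    (fun p => mul_le_mul_of_nonneg_left (sq_le_sq.2 (h p.1 p.2)) (G.μ_nonneg _ _)) hg

theorem finiteEnergy_of_finite {f : V → ℝ} (hf : (Function.support f).Finite) :
    G.FiniteEnergy f := by
  refine G.summable_of_finite hf fun p hp => ⟨fun h => hp (by rw [h, zero_mul]), ?_⟩
  by_contra hn
  simp only [Function.mem_support, not_or, not_not] at hn
  exact hp (by rw [hn.1, hn.2]; ring)

theorem hasSum_fiber {f g : V → ℝ} (x : V) :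
    HasSum (fun y => G.μ x y * (f y - f x) * (g y - g x) / 2) (G.m x * G.gammaForm f g x) := by
  rw [m_mul_gammaForm]
  exact G.hasSum_nbrs fun y hy => by rw [hy]; ring

/-- `Q(f, g) = ∑ m Γ(f, g)`. -/
theorem FiniteEnergy.hasSum_gammaForm {f g : V → ℝ} (hf : G.FiniteEnergy f)
    (hg : G.FiniteEnergy g) : HasSum (fun x => G.m x * G.gammaForm f g x) (G.energy f g) :=
  ((hf.summable_mul hg).hasSum.div_const 2).prod_fiberwise fun x => hasSum_fiber x

theorem energy_comm (f g : V → ℝ) : G.energy f g = G.energy g f := by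
  unfold energy
  simp only [mul_right_comm]

theorem energy_sub_left {f f' g : V → ℝ} (hf : G.FiniteEnergy f) (hf' : G.FiniteEnergy f')
    (hg : G.FiniteEnergy g) : G.energy (f - f') g = G.energy f g - G.energy f' g := by
  refine ((hf.sub hf').hasSum_gammaForm hg).unique ?_
  refine ((hf.hasSum_gammaForm hg).sub (hf'.hasSum_gammaForm hg)).congr_fun fun x => ?_
  rw [gammaForm_sub_left, mul_sub]

theorem energy_add_left {f f' g : V → ℝ} (hf : G.FiniteEnergy f) (hf' : G.FiniteEnergy f')
    (hg : G.FiniteEnergy g) : G.energy (f + f') g = G.energy f g + G.energy f' g := by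
  refine ((hf.add hf').hasSum_gammaForm hg).unique ?_
  refine ((hf.hasSum_gammaForm hg).add (hf'.hasSum_gammaForm hg)).congr_fun fun x => ?_
  rw [gammaForm_add_left, mul_add]

theorem energy_smul_left (c : ℝ) (f g : V → ℝ) : G.energy (c • f) g = c * G.energy f g := by
  unfold energy
  rw [← mul_div_assoc, ← tsum_mul_left]
  congr 1
  refine tsum_congr fun p => ?_
  simp only [Pi.smul_apply, smul_eq_mul]
  ring

theorem energy_self_nonneg (f : V → ℝ) : 0 ≤ G.energy f f := by
  refine div_nonneg (tsum_nonneg fun p => ?_) zero_le_two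
  rw [mul_assoc]
  exact mul_nonneg (G.μ_nonneg _ _) (mul_self_nonneg _)

/-- Green's formula `Q(w, v) = -∑ m v Δ w`, when the double sum on the right converges. -/
theorem hasSum_green {w v : V → ℝ}
    (hs : Summable fun p : V × V => G.μ p.1 p.2 * (w p.2 - w p.1) * v p.1) :
    HasSum (fun x => G.m x * G.lap w x * v x) (-G.energy w v) := by
  obtain ⟨a, ha⟩ := hs
  have h1 : HasSum (fun x => G.m x * G.lap w x * v x) a := by
    refine ha.prod_fiberwise fun x => ?_
    rw [m_mul_lap, Finset.sum_mul]
    exact G.hasSum_nbrs fun y hy => by rw [hy]; ring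
  have h2 : HasSum (fun p : V × V => G.μ p.1 p.2 * (w p.2 - w p.1) * (v p.2 - v p.1))
      (-(a + a)) := by
    have h3 : HasSum (fun p : V × V => G.μ p.2 p.1 * (w p.1 - w p.2) * v p.2) a :=
      (Equiv.prodComm V V).hasSum_iff.2 ha
    refine (ha.add h3).neg.congr_fun fun p => ?_
    rw [G.μ_symm p.2 p.1]
    ring
  have h3 : -G.energy w v = a := by
    rw [energy, h2.tsum_eq]
    ring
  rwa [h3]

theorem hasSum_green_right {w v : V → ℝ} (hv : (Function.support v).Finite) :
    HasSum (fun x => G.m x * G.lap w x * v x) (-G.energy w v) := by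
  refine hasSum_green (G.summable_of_finite hv fun p hp => ⟨fun h => hp ?_, Or.inl fun h => hp ?_⟩)
  · rw [h]; ring
  · rw [h]; ring

theorem hasSum_green_left {w v : V → ℝ} (hw : (Function.support w).Finite) :
    HasSum (fun x => G.m x * G.lap w x * v x) (-G.energy w v) := by
  refine hasSum_green (G.summable_of_finite hw fun p hp => ⟨fun h => hp ?_, ?_⟩)
  · rw [h]; ring
  · by_contra hn
    simp only [Function.mem_support, not_or, not_not] at hn
    exact hp (by rw [hn.1, hn.2]; ring)

end WeightedGraph

/-! ### The Hilbert space `ℓ²(V, m)` -/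

namespace WeightedGraph

variable {V : Type*} [MeasurableSpace V] {G : WeightedGraph V}

theorem ext_coe {f g : G.L2} (h : ∀ x, f x = g x) : f = g :=
  Lp.ext (Eventually.of_forall h)

variable [DiscreteMeasurableSpace V]

theorem lintegral_vertexMeasure (F : V → ℝ≥0∞) :
    ∫⁻ x, F x ∂G.vertexMeasure = ∑' x, ENNReal.ofReal (G.m x) * F x := by
  rw [vertexMeasure, lintegral_sum_measure]
  simp

theorem integrable_vertexMeasure_iff {f : V → ℝ} :
    Integrable f G.vertexMeasure ↔ Summable fun x => G.m x * ‖f x‖ := by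
  have h1 : ∀ x, ENNReal.ofReal (G.m x) * ‖f x‖ₑ = ENNReal.ofReal (G.m x * ‖f x‖) := fun x => by
    rw [ENNReal.ofReal_mul (G.m_pos x).le, ofReal_norm]
  have h2 : Integrable f G.vertexMeasure ↔ ∑' x, ENNReal.ofReal (G.m x * ‖f x‖) < ∞ := by
    rw [Integrable, and_iff_right (Measurable.of_discrete.aestronglyMeasurable),
      HasFiniteIntegral, lintegral_vertexMeasure]
    simp only [h1]
  rw [h2]
  refine ⟨fun h => ?_, fun h => h.tsum_ofReal_lt_top⟩
  refine (ENNReal.summable_toReal h.ne).congr fun x => ?_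
  rw [ENNReal.toReal_ofReal (mul_nonneg (G.m_pos x).le (norm_nonneg _))]

theorem hasSum_integral {f : V → ℝ} (hf : Integrable f G.vertexMeasure) :
    HasSum (fun x => G.m x * f x) (∫ x, f x ∂G.vertexMeasure) := by
  refine (hasSum_integral_measure (μ := fun x => ENNReal.ofReal (G.m x) • Measure.dirac x)
    hf).congr_fun fun x => ?_
  rw [integral_smul_measure, integral_dirac, ENNReal.toReal_ofReal (G.m_pos x).le, smul_eq_mul]

theorem memLp_two_iff {f : V → ℝ} :
    MemLp f 2 G.vertexMeasure ↔ Summable fun x => G.m x * f x ^ 2 := by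
  rw [memLp_two_iff_integrable_sq Measurable.of_discrete.aestronglyMeasurable,
    integrable_vertexMeasure_iff]
  simp

theorem memLp_of_finite {f : V → ℝ} (hf : (Function.support f).Finite) :
    MemLp f 2 G.vertexMeasure := by
  rw [memLp_two_iff]
  refine summable_of_hasFiniteSupport (hf.subset fun x hx => fun h => hx ?_)
  simp [h]

/-- The only null set of the vertex measure is the empty set. -/
theorem eq_of_ae_eq {f g : V → ℝ} (h : f =ᵐ[G.vertexMeasure] g) : f = g := by
  funext x
  have h1 : ∀ᵐ y ∂G.vertexMeasure, f y = g y := h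
  rw [vertexMeasure, Measure.ae_sum_iff' MeasurableSet.of_discrete] at h1
  have h2 := h1 x
  rw [Measure.ae_ennreal_smul_measure_iff (by simpa using G.m_pos x)] at h2
  simpa [ae_dirac_eq] using h2

theorem coe_toLp {f : V → ℝ} (hf : MemLp f 2 G.vertexMeasure) : ⇑(hf.toLp f) = f :=
  eq_of_ae_eq hf.coeFn_toLp

theorem coe_add (f g : G.L2) : ⇑(f + g) = ⇑f + ⇑g := eq_of_ae_eq (Lp.coeFn_add f g)

theorem coe_sub (f g : G.L2) : ⇑(f - g) = ⇑f - ⇑g := eq_of_ae_eq (Lp.coeFn_sub f g)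

theorem coe_smul (c : ℝ) (f : G.L2) : ⇑(c • f) = c • ⇑f := eq_of_ae_eq (Lp.coeFn_smul c f)

theorem coe_zero : ⇑(0 : G.L2) = 0 := eq_of_ae_eq (Lp.coeFn_zero ℝ 2 G.vertexMeasure)

theorem hasSum_inner (f g : G.L2) : HasSum (fun x => G.m x * (f x * g x)) (inner ℝ f g) := by
  rw [L2.inner_def]
  refine (hasSum_integral (L2.integrable_inner f g)).congr_fun fun x => ?_
  simp [mul_comm]

theorem hasSum_inner' (f g : G.L2) : HasSum (fun x => G.m x * f x * g x) (inner ℝ f g) := by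
  simpa only [mul_assoc] using hasSum_inner f g

theorem inner_eq_pairing (f g : G.L2) : inner ℝ f g = G.pairing f g :=
  (hasSum_inner' f g).tsum_eq.symm

theorem hasSum_norm_sq (f : G.L2) : HasSum (fun x => G.m x * f x ^ 2) (‖f‖ ^ 2) := by
  rw [← real_inner_self_eq_norm_sq]
  simpa only [sq] using hasSum_inner f f

theorem summable_sq (f : G.L2) : Summable fun x => G.m x * f x ^ 2 := (hasSum_norm_sq f).summable

theorem m_mul_sq_le (f : G.L2) (x : V) : G.m x * f x ^ 2 ≤ ‖f‖ ^ 2 :=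
  le_hasSum (hasSum_norm_sq f) x fun y _ => mul_nonneg (G.m_pos y).le (sq_nonneg _)

/-- The evaluation at a vertex, as a bounded functional on `ℓ²`. -/
noncomputable def evalCLM (G : WeightedGraph V) (x : V) : G.L2 →L[ℝ] ℝ :=
  LinearMap.mkContinuous
    { toFun := fun f => f x
      map_add' := fun f g => by rw [coe_add]; rfl
      map_smul' := fun c f => by rw [coe_smul]; rfl }
    (√(G.m x))⁻¹ fun f => by
      have h1 := G.m_pos x
      have h2 := m_mul_sq_le f x
      rw [inv_mul_eq_div, le_div_iff₀ (Real.sqrt_pos.2 h1)]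
      refine abs_le_of_sq_le_sq' ?_ (norm_nonneg f) |>.2
      change (|f x| * √(G.m x)) ^ 2 ≤ _
      rw [mul_pow, Real.sq_sqrt h1.le, sq_abs, mul_comm]
      exact h2

@[simp] theorem evalCLM_apply (x : V) (f : G.L2) : G.evalCLM x f = f x := rfl

/-- The indicator function of a vertex, as an element of `ℓ²`. -/
noncomputable def vertexL2 (G : WeightedGraph V) (x : V) : G.L2 :=
  open Classical in
  (memLp_of_finite (f := Pi.single x (1 : ℝ)) ((Set.finite_singleton x).subset
    Pi.support_single_subset)).toLp _

open Classical in
theorem coe_vertexL2 (x : V) : ⇑(G.vertexL2 x) = Pi.single x (1 : ℝ) := coe_toLp _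

theorem inner_vertexL2 (f : G.L2) (x : V) : inner ℝ f (G.vertexL2 x) = G.m x * f x := by
  classical
  refine (hasSum_inner f _).unique ?_
  have h := hasSum_single (f := fun y => G.m y * (f y * G.vertexL2 x y)) x fun y hy => by
    rw [coe_vertexL2, Pi.single_eq_of_ne hy]; simp
  simpa [coe_vertexL2] using h

theorem vertexL2_nonneg (x y : V) : 0 ≤ G.vertexL2 x y := by
  classical
  rw [coe_vertexL2]
  rw [Pi.single_apply]
  split_ifs <;> norm_num

end WeightedGraph

/-! ### Cut-off functions and the form domain of a complete graph -/

namespace WeightedGraph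

variable {V : Type*} {G : WeightedGraph V}

/-- A sequence of finitely supported cut-off functions with values in `[0, 1]` that converges
pointwise to `1` and whose gradients tend to `0` uniformly. -/
structure IsCutoff (G : WeightedGraph V) (η : ℕ → V → ℝ) : Prop where
  finite : ∀ k, (Function.support (η k)).Finite
  nonneg : ∀ k x, 0 ≤ η k x
  le_one : ∀ k x, η k x ≤ 1
  tendsto : ∀ x, Tendsto (fun k => η k x) atTop (𝓝 1)
  gamma_le : ∀ k x, G.gamma (η k) x ≤ 1 / ((k : ℝ) + 1)

theorem Complete.exists_isCutoff (h : G.Complete) : ∃ η, G.IsCutoff η := by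
  obtain ⟨η, h1, h2, h3, h4⟩ := h
  refine ⟨fun k x => max (η k x) 0, ⟨fun k => (h1 k).subset fun x hx hx' => hx ?_,
    fun k x => le_max_right _ _, fun k x => max_le ?_ zero_le_one, fun x => ?_, fun k x => ?_⟩⟩
  · simp [hx']
  · exact Monotone.ge_of_tendsto (f := fun k => η k x) (fun i j hij => h2 hij x) (h3 x) k
  · simpa using (h3 x).max (tendsto_const_nhds (x := (0 : ℝ)))
  · exact (G.gamma_le_gamma_of_abs_sub_le (fun x y => abs_max_sub_max_le_abs _ _ _) x).trans
      (h4 k x)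

theorem hasSum_sq_mul_grad {f φ : V → ℝ} {C : ℝ} (hφ : ∀ x, G.gamma φ x ≤ C)
    (hf : Summable fun x => G.m x * f x ^ 2) :
    Summable (fun p : V × V => G.μ p.1 p.2 * f p.1 ^ 2 * (φ p.2 - φ p.1) ^ 2) ∧
      ∑' p : V × V, G.μ p.1 p.2 * f p.1 ^ 2 * (φ p.2 - φ p.1) ^ 2 ≤
        2 * C * ∑' x, G.m x * f x ^ 2 := by
  have h0 : ∀ x, HasSum (fun y => G.μ x y * f x ^ 2 * (φ y - φ x) ^ 2)
      (2 * f x ^ 2 * (G.m x * G.gamma φ x)) := fun x => by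
    refine ((hasSum_fiber (G := G) (f := φ) (g := φ) x).mul_left (2 * f x ^ 2)).congr_fun
      fun y => ?_
    ring
  have h1 : ∀ x, 2 * f x ^ 2 * (G.m x * G.gamma φ x) ≤ 2 * C * (G.m x * f x ^ 2) := fun x => by
    have := mul_le_mul_of_nonneg_left (hφ x) (mul_nonneg (G.m_pos x).le (sq_nonneg (f x)))
    linarith
  have h2 : ∀ p : V × V, 0 ≤ G.μ p.1 p.2 * f p.1 ^ 2 * (φ p.2 - φ p.1) ^ 2 := fun p =>
    mul_nonneg (mul_nonneg (G.μ_nonneg _ _) (sq_nonneg _)) (sq_nonneg _)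
  have h3 : Summable fun x => 2 * f x ^ 2 * (G.m x * G.gamma φ x) :=
    Summable.of_nonneg_of_le (fun x => mul_nonneg (mul_nonneg zero_le_two (sq_nonneg _))
      (mul_nonneg (G.m_pos x).le (G.gamma_nonneg φ x))) h1 (hf.mul_left _)
  have h4 : Summable (fun p : V × V => G.μ p.1 p.2 * f p.1 ^ 2 * (φ p.2 - φ p.1) ^ 2) := by
    rw [summable_prod_of_nonneg h2]
    exact ⟨fun x => (h0 x).summable, h3.congr fun x => (h0 x).tsum_eq.symm⟩
  refine ⟨h4, ?_⟩
  rw [← (h4.hasSum.prod_fiberwise h0).tsum_eq, ← tsum_mul_left]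
  exact h3.tsum_le_tsum h1 (hf.mul_left _)

theorem IsCutoff.finite_mul {η : ℕ → V → ℝ} (hη : G.IsCutoff η) (f : V → ℝ) (k : ℕ) :
    (Function.support (η k * f)).Finite :=
  (hη.finite k).subset (Function.support_mul_subset_left _ _)

theorem IsCutoff.sq_sub_one_le {η : ℕ → V → ℝ} (hη : G.IsCutoff η) (k : ℕ) (x : V) :
    (η k x - 1) ^ 2 ≤ 1 := by
  nlinarith [hη.nonneg k x, hη.le_one k x]

theorem IsCutoff.tendsto_pairing {η : ℕ → V → ℝ} (hη : G.IsCutoff η) {f : V → ℝ}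
    (hf : Summable fun x => G.m x * f x ^ 2) :
    Tendsto (fun k => G.pairing (η k * f - f) (η k * f - f)) atTop (𝓝 0) := by
  have h1 : ∀ k x, G.m x * (η k * f - f) x * (η k * f - f) x =
      (η k x - 1) ^ 2 * (G.m x * f x ^ 2) := fun k x => by
    simp only [Pi.sub_apply, Pi.mul_apply]; ring
  have h2 := tendsto_tsum_of_dominated_convergence (𝓕 := atTop)
    (f := fun k x => (η k x - 1) ^ 2 * (G.m x * f x ^ 2)) (g := fun _ => 0) hf
    (fun x => by
      simpa using (((hη.tendsto x).sub_const 1).pow 2).mul_const (G.m x * f x ^ 2))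
    (Eventually.of_forall fun k x => by
      have h3 := mul_nonneg (G.m_pos x).le (sq_nonneg (f x))
      rw [Real.norm_of_nonneg (mul_nonneg (sq_nonneg _) h3)]
      exact mul_le_of_le_one_left h3 (hη.sq_sub_one_le k x))
  rw [tsum_zero] at h2
  refine h2.congr fun k => ?_
  unfold pairing
  exact (tsum_congr (h1 k)).symm

/-- On a complete graph, `η_k f → f` in energy; the commutator term is bounded by
`‖f‖² sup Γ(η_k)`. -/
theorem IsCutoff.tendsto_energy {η : ℕ → V → ℝ} (hη : G.IsCutoff η) {f : V → ℝ}
    (hf : Summable fun x => G.m x * f x ^ 2) (hE : G.FiniteEnergy f) :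
    Tendsto (fun k => G.energy (η k * f - f) (η k * f - f)) atTop (𝓝 0) := by
  have h1 := tendsto_tsum_of_dominated_convergence (𝓕 := atTop)
    (f := fun k (p : V × V) => (η k p.2 - 1) ^ 2 * (G.μ p.1 p.2 * (f p.2 - f p.1) ^ 2))
    (g := fun _ => 0) hE
    (fun p => by
      simpa using (((hη.tendsto p.2).sub_const 1).pow 2).mul_const
        (G.μ p.1 p.2 * (f p.2 - f p.1) ^ 2))
    (Eventually.of_forall fun k p => by
      have h3 := mul_nonneg (G.μ_nonneg p.1 p.2) (sq_nonneg (f p.2 - f p.1))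
      rw [Real.norm_of_nonneg (mul_nonneg (sq_nonneg _) h3)]
      exact mul_le_of_le_one_left h3 (hη.sq_sub_one_le k p.2))
  rw [tsum_zero] at h1
  have h2 : Tendsto (fun k : ℕ => 2 * (1 / ((k : ℝ) + 1)) * ∑' x, G.m x * f x ^ 2) atTop (𝓝 0) := by
    simpa using ((tendsto_one_div_add_atTop_nhds_zero_nat (𝕜 := ℝ)).const_mul 2).mul_const
      (∑' x, G.m x * f x ^ 2)
  have h3 := h1.add h2
  rw [add_zero] at h3
  refine squeeze_zero (fun k => energy_self_nonneg _) (fun k => ?_) h3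
  obtain ⟨h4, h5⟩ := hasSum_sq_mul_grad (hη.gamma_le k) hf
  have h6 : Summable fun p : V × V =>
      (η k p.2 - 1) ^ 2 * (G.μ p.1 p.2 * (f p.2 - f p.1) ^ 2) := by
    refine Summable.of_nonneg_of_le (fun p => mul_nonneg (sq_nonneg _)
      (mul_nonneg (G.μ_nonneg _ _) (sq_nonneg _))) (fun p => ?_) hE
    exact mul_le_of_le_one_left (mul_nonneg (G.μ_nonneg _ _) (sq_nonneg _))
      (hη.sq_sub_one_le k p.2)
  refine le_trans ?_ (add_le_add_right h5 _)
  rw [← h6.tsum_add h4, energy, div_le_iff₀ zero_lt_two, ← tsum_mul_right]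
  have h7 := (finiteEnergy_of_finite (G := G) (hη.finite_mul f k)).sub hE
  refine (h7.summable_mul h7).tsum_le_tsum (fun p => ?_) ((h6.add h4).mul_right 2)
  have h8 := G.μ_nonneg p.1 p.2
  -- Leibniz rule for the difference of `(η_k - 1) f` along an edge
  set a := (η k p.2 - 1) * (f p.2 - f p.1) with ha
  set b := f p.1 * (η k p.2 - η k p.1) with hb
  have h9 : (η k * f - f) p.2 - (η k * f - f) p.1 = a + b := by
    simp only [Pi.sub_apply, Pi.mul_apply, ha, hb]; ring
  have h10 : ((η k p.2 - 1) ^ 2 * (G.μ p.1 p.2 * (f p.2 - f p.1) ^ 2) +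
      G.μ p.1 p.2 * f p.1 ^ 2 * (η k p.2 - η k p.1) ^ 2) * 2 =
      G.μ p.1 p.2 * (2 * a ^ 2 + 2 * b ^ 2) := by
    rw [ha, hb]; ring
  rw [h9, h10, mul_assoc]
  refine mul_le_mul_of_nonneg_left ?_ h8
  nlinarith [sq_nonneg (a - b)]

variable [MeasurableSpace V]

theorem mem_formDomain_of_finite [DiscreteMeasurableSpace V] {f : V → ℝ}
    (hf : (Function.support f).Finite) : f ∈ G.formDomain := by
  refine ⟨memLp_of_finite hf, finiteEnergy_of_finite hf, fun _ => f, fun _ => hf, ?_⟩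
  simp [pairing, energy]

/-- On a complete graph, the form domain consists of all functions in `ℓ²` of finite energy. -/
theorem Complete.mem_formDomain_iff [DiscreteMeasurableSpace V] (hG : G.Complete) {f : V → ℝ} :
    f ∈ G.formDomain ↔ MemLp f 2 G.vertexMeasure ∧ G.FiniteEnergy f := by
  refine ⟨fun h => ⟨h.1, h.2.1⟩, fun h => ⟨h.1, h.2, ?_⟩⟩
  obtain ⟨η, hη⟩ := hG.exists_isCutoff
  have h1 := memLp_two_iff.1 h.1
  exact ⟨fun k => η k * f, hη.finite_mul f,
    by simpa using (hη.tendsto_pairing h1).add (hη.tendsto_energy h1 h.2)⟩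

end WeightedGraph

/-! ### The Laplacian generates the heat semigroup -/

/-- The square summable functions on pairs of vertices. -/
abbrev EdgeL2 (V : Type*) : Type _ := lp (fun _ : V × V => ℝ) 2

namespace WeightedGraph

variable {V : Type*} {G : WeightedGraph V}

theorem memlp_two_iff {F : V × V → ℝ} : Memℓp F 2 ↔ Summable fun p => F p ^ 2 := by
  rw [memℓp_gen_iff (by norm_num)]
  simp

/-- The weighted gradient `(x, y) ↦ √μ_{xy} (f y - f x)` of a function of finite energy. -/
noncomputable def grad (f : V → ℝ) (hf : G.FiniteEnergy f) : EdgeL2 V :=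
  ⟨fun p => √(G.μ p.1 p.2) * (f p.2 - f p.1), memlp_two_iff.2 <| Summable.congr hf fun p => by
    rw [mul_pow, Real.sq_sqrt (G.μ_nonneg _ _)]⟩

theorem grad_apply {f : V → ℝ} (hf : G.FiniteEnergy f) (p : V × V) :
    grad f hf p = √(G.μ p.1 p.2) * (f p.2 - f p.1) := rfl

theorem inner_grad {f g : V → ℝ} (hf : G.FiniteEnergy f) (hg : G.FiniteEnergy g) :
    inner ℝ (grad f hf) (grad g hg) = 2 * G.energy f g := by
  rw [lp.inner_eq_tsum, energy, mul_div_cancel₀ _ two_ne_zero]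
  refine tsum_congr fun p => ?_
  have h := Real.mul_self_sqrt (G.μ_nonneg p.1 p.2)
  rw [grad_apply, grad_apply]
  simp only [RCLike.inner_apply, conj_trivial]
  linear_combination ((g p.2 - g p.1) * (f p.2 - f p.1)) * h

theorem norm_grad_sq {f : V → ℝ} (hf : G.FiniteEnergy f) :
    ‖grad f hf‖ ^ 2 = 2 * G.energy f f := by
  rw [← real_inner_self_eq_norm_sq, inner_grad]

theorem sq_energy_le {f g : V → ℝ} (hf : G.FiniteEnergy f) (hg : G.FiniteEnergy g) :
    G.energy f g ^ 2 ≤ G.energy f f * G.energy g g := by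
  have h1 := abs_real_inner_le_norm (grad f hf) (grad g hg)
  have h2 := pow_le_pow_left₀ (abs_nonneg _) h1 2
  rw [sq_abs, mul_pow, norm_grad_sq, norm_grad_sq, inner_grad] at h2
  linarith

variable [MeasurableSpace V]

theorem mem_laplacianGraph_iff {f g : G.L2} : (f, g) ∈ G.laplacianGraph ↔
    ⇑f ∈ G.formDomain ∧ ∀ v ∈ G.formDomain, G.energy f v = -G.pairing g v := Iff.rfl

variable [DiscreteMeasurableSpace V]

theorem pairing_eq_inner (g : G.L2) {v : V → ℝ} (hv : MemLp v 2 G.vertexMeasure) :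
    G.pairing g v = inner ℝ g (hv.toLp v) := by
  rw [inner_eq_pairing, coe_toLp]

theorem Complete.coe_mem_formDomain_iff (hG : G.Complete) {f : G.L2} :
    ⇑f ∈ G.formDomain ↔ G.FiniteEnergy f := by
  rw [hG.mem_formDomain_iff, and_iff_right (Lp.memLp f)]

/-- On a complete graph, the graph of `L` as a linear subspace. -/
noncomputable def laplacianSubmodule (hG : G.Complete) : Submodule ℝ (G.L2 × G.L2) where
  carrier := G.laplacianGraph
  zero_mem' := by
    refine mem_laplacianGraph_iff.2 ⟨?_, fun v hv => ?_⟩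
    · rw [coe_zero]
      exact mem_formDomain_of_finite (by simp)
    · rw [coe_zero]
      simp [energy, pairing]
  add_mem' := by
    rintro ⟨f, g⟩ ⟨f', g'⟩ h h'
    obtain ⟨h1, h2⟩ := mem_laplacianGraph_iff.1 h
    obtain ⟨h1', h2'⟩ := mem_laplacianGraph_iff.1 h'
    refine mem_laplacianGraph_iff.2 ⟨?_, fun v hv => ?_⟩
    · rw [hG.coe_mem_formDomain_iff, coe_add]
      exact h1.2.1.add h1'.2.1
    · rw [coe_add, energy_add_left h1.2.1 h1'.2.1 hv.2.1, h2 v hv, h2' v hv,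
        pairing_eq_inner _ hv.1, pairing_eq_inner _ hv.1, pairing_eq_inner _ hv.1, inner_add_left]
      ring
  smul_mem' := by
    rintro c ⟨f, g⟩ h
    obtain ⟨h1, h2⟩ := mem_laplacianGraph_iff.1 h
    refine mem_laplacianGraph_iff.2 ⟨?_, fun v hv => ?_⟩
    · rw [hG.coe_mem_formDomain_iff, coe_smul]
      exact h1.2.1.const_smul c
    · rw [coe_smul, energy_smul_left, h2 v hv,
        pairing_eq_inner _ hv.1, pairing_eq_inner _ hv.1, real_inner_smul_left]
      ring

theorem mem_laplacianSubmodule_iff (hG : G.Complete) {p : G.L2 × G.L2} :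
    p ∈ laplacianSubmodule hG ↔ p ∈ G.laplacianGraph := Iff.rfl

theorem sub_mem_laplacianGraph (hG : G.Complete) {f f' g g' : G.L2}
    (hf : (f, f') ∈ G.laplacianGraph) (hg : (g, g') ∈ G.laplacianGraph) :
    (f - g, f' - g') ∈ G.laplacianGraph := by
  rw [← mem_laplacianSubmodule_iff hG] at hf hg ⊢
  rw [← Prod.mk_sub_mk]
  exact Submodule.sub_mem _ hf hg

theorem energy_eq_of_mem_laplacianGraph {f g : G.L2} (h : (f, g) ∈ G.laplacianGraph) :
    G.energy f f = -inner ℝ g f := by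
  rw [(mem_laplacianGraph_iff.1 h).2 f h.1, inner_eq_pairing]

/-- `L` acts on its domain as the formal Laplacian. -/
theorem eq_lap_of_mem_laplacianGraph {f g : G.L2} (h : (f, g) ∈ G.laplacianGraph) (x : V) :
    g x = G.lap f x := by
  classical
  have hfin : (Function.support ⇑(G.vertexL2 x)).Finite := by
    rw [coe_vertexL2]
    exact (Set.finite_singleton x).subset Pi.support_single_subset
  have h1 := (mem_laplacianGraph_iff.1 h).2 _ (mem_formDomain_of_finite hfin)
  rw [← inner_eq_pairing, inner_vertexL2] at h1
  have h2 := hasSum_green_right (G := G) (w := f) hfin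
  have h3 := hasSum_single (f := fun y => G.m y * G.lap f y * G.vertexL2 x y) x fun y hy => by
    rw [coe_vertexL2, Pi.single_eq_of_ne hy, mul_zero]
  have h4 := h2.unique h3
  rw [h1, coe_vertexL2, Pi.single_eq_same, mul_one, neg_neg] at h4
  exact mul_left_cancel₀ (G.m_pos x).ne' h4

/-- Finitely supported functions lie in the domain of `L`. -/
theorem mem_laplacianGraph_of_finite {f : G.L2} (hf : (Function.support f).Finite) :
    (f, (memLp_of_finite (G.finite_support_lap hf)).toLp (G.lap f)) ∈ G.laplacianGraph := by
  refine mem_laplacianGraph_iff.2 ⟨mem_formDomain_of_finite hf, fun v _ => ?_⟩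
  rw [coe_toLp, pairing, (hasSum_green_left (G := G) (v := v) hf).tsum_eq, neg_neg]

/-- The graph of the rescaled gradient `f ↦ √(c / 2) df`. It is closed as an intersection of
closed conditions on values, and its Hilbert space structure is that of the form domain with the
norm `‖f‖² + c Q(f)`. -/
noncomputable def gradGraph (G : WeightedGraph V) (c : ℝ) :
    Submodule ℝ (WithLp 2 (G.L2 × EdgeL2 V)) where
  carrier := {z | ∀ p : V × V, z.snd p =
    √(c / 2) * (√(G.μ p.1 p.2) * (G.evalCLM p.2 z.fst - G.evalCLM p.1 z.fst))}
  zero_mem' := fun p => by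
    rw [WithLp.zero_fst, WithLp.zero_snd, map_zero, map_zero]
    simp
  add_mem' := fun {a b} ha hb p => by
    simp only [WithLp.add_snd, WithLp.add_fst, map_add, lp.coeFn_add, Pi.add_apply, ha p, hb p]
    ring
  smul_mem' := fun r a ha p => by
    simp only [WithLp.smul_snd, WithLp.smul_fst, map_smul, lp.coeFn_smul, Pi.smul_apply, ha p,
      smul_eq_mul]
    ring

theorem isClosed_gradGraph (c : ℝ) : IsClosed (G.gradGraph c : Set (WithLp 2 (G.L2 × EdgeL2 V))) := by
  have h1 : Continuous fun z : WithLp 2 (G.L2 × EdgeL2 V) => z.fst :=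
    WithLp.continuous_fst 2 _ _
  have h2 : Continuous fun z : WithLp 2 (G.L2 × EdgeL2 V) => z.snd :=
    WithLp.continuous_snd 2 _ _
  have h3 : (G.gradGraph c : Set (WithLp 2 (G.L2 × EdgeL2 V))) = ⋂ p : V × V,
      {z | z.snd p =
        √(c / 2) * (√(G.μ p.1 p.2) * (G.evalCLM p.2 z.fst - G.evalCLM p.1 z.fst))} := by
    ext z
    simp only [Set.mem_iInter]
    rfl
  rw [h3]
  refine isClosed_iInter fun p => isClosed_eq ?_ ?_
  · exact (lp.evalCLM ℝ (fun _ : V × V => ℝ) 2 p).continuous.comp h2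
  · fun_prop

/-- Riesz's theorem in the form domain: `1 - c L` is onto. The solution of `f - c L f = h` is the
first component of the projection of `(h, 0)` onto the graph of `√(c / 2) d`. -/
theorem exists_resolvent (hG : G.Complete) {c : ℝ} (hc : 0 < c) (h : G.L2) :
    ∃ p ∈ G.laplacianGraph, p.1 - c • p.2 = h := by
  have : CompleteSpace (G.gradGraph c) := (isClosed_gradGraph c).completeSpace_coe
  set z := (G.gradGraph c).starProjection (WithLp.toLp 2 (h, 0)) with hz
  have hzm : z ∈ G.gradGraph c := Submodule.starProjection_apply_mem _ _
  have hc' : 0 < √(c / 2) := Real.sqrt_pos.2 (by positivity)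
  have hE : G.FiniteEnergy z.fst := by
    have h1 := (memlp_two_iff.1 (lp.memℓp z.snd)).mul_left ((√(c / 2))⁻¹ ^ 2)
    refine h1.congr fun p => ?_
    rw [hzm p, evalCLM_apply, evalCLM_apply, ← mul_pow, inv_mul_cancel_left₀ hc'.ne', mul_pow,
      Real.sq_sqrt (G.μ_nonneg _ _)]
  have hz2 : z.snd = √(c / 2) • grad z.fst hE := by
    ext p
    rw [hzm p]
    rfl
  refine ⟨(z.fst, c⁻¹ • (z.fst - h)), mem_laplacianGraph_iff.2
    ⟨hG.coe_mem_formDomain_iff.2 hE, fun v hv => ?_⟩, ?_⟩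
  · have hw : WithLp.toLp 2 (hv.1.toLp v, √(c / 2) • grad v hv.2.1) ∈ G.gradGraph c := by
      intro p
      simp only [evalCLM_apply, coe_toLp, WithLp.toLp_fst, WithLp.toLp_snd]
      rfl
    have h1 := (G.gradGraph c).starProjection_inner_eq_zero (WithLp.toLp 2 (h, 0)) _ hw
    rw [← hz, WithLp.prod_inner_apply] at h1
    simp only [WithLp.ofLp_fst, WithLp.ofLp_snd, WithLp.sub_fst, WithLp.sub_snd, WithLp.toLp_fst,
      WithLp.toLp_snd, zero_sub, hz2, inner_neg_left, inner_smul_left, inner_smul_right,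
      inner_grad, conj_trivial] at h1
    rw [pairing_eq_inner _ hv.1, real_inner_smul_left, inner_sub_left]
    rw [inner_sub_left] at h1
    have h2 := Real.mul_self_sqrt (show 0 ≤ c / 2 by positivity)
    field_simp
    linear_combination -h1 - (2 * G.energy z.fst v) * h2
  · dsimp only
    rw [smul_inv_smul₀ hc.ne']
    abel

/-- `L` is m-dissipative, as `⟪L f, f⟫ = -Q(f, f)`. -/
theorem isMDissipative (hG : G.Complete) :
    DissipativeRelation.IsMDissipative (laplacianSubmodule hG) where
  inner_nonpos := by
    rintro ⟨f, g⟩ h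
    have := energy_eq_of_mem_laplacianGraph ((mem_laplacianSubmodule_iff hG).1 h)
    linarith [energy_self_nonneg (G := G) f]
  exists_resolvent := fun _ hc h => exists_resolvent hG hc h

/-- The heat semigroup is generated by `L`: a semigroup with this generator exists. -/
theorem heatSemigroup_hasGenerator (hG : G.Complete) :
    G.heatSemigroup.HasGenerator G.laplacianGraph :=
  Classical.epsilon_spec (p := fun T : C0Semigroup G.L2 => T.HasGenerator G.laplacianGraph) <|
    DissipativeRelation.exists_hasGenerator (isMDissipative hG) fun g hg => ext_coe fun x => by
      rw [eq_lap_of_mem_laplacianGraph ((mem_laplacianSubmodule_iff hG).1 hg) x, coe_zero]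
      simp [lap]

end WeightedGraph

/-! ### Positivity and symmetry of the heat semigroup -/

namespace WeightedGraph

variable {V : Type*} [MeasurableSpace V] [DiscreteMeasurableSpace V] {G : WeightedGraph V}

/-- The negative part `x ↦ max (-f x) 0` of a function in `ℓ²`. -/
noncomputable def negL2 (f : G.L2) : G.L2 :=
  MemLp.toLp (fun x => max (-f x) 0) <| memLp_two_iff.2 <|
    Summable.of_nonneg_of_le (fun x => mul_nonneg (G.m_pos x).le (sq_nonneg _))
      (fun x => mul_le_mul_of_nonneg_left (by
        rcases le_total (-f x) 0 with h | h
        · rw [max_eq_right h]; nlinarith [sq_nonneg (f x)]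
        · rw [max_eq_left h, neg_sq]) (G.m_pos x).le) (summable_sq f)

theorem negL2_apply (f : G.L2) (x : V) : negL2 f x = max (-f x) 0 :=
  congrFun (coe_toLp _) x

theorem sq_max_neg_expansion (a h : ℝ) :
    |max (-(a + h)) 0 ^ 2 - max (-a) 0 ^ 2 + 2 * (max (-a) 0 * h)| ≤ h ^ 2 := by
  rw [abs_le]
  rcases le_total (-(a + h)) 0 with h1 | h1 <;> rcases le_total (-a) 0 with h2 | h2
  · rw [max_eq_right h1, max_eq_right h2]; constructor <;> nlinarith
  · rw [max_eq_right h1, max_eq_left h2]; constructor <;> nlinarith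
  · rw [max_eq_left h1, max_eq_right h2]; constructor <;> nlinarith
  · rw [max_eq_left h1, max_eq_left h2]; constructor <;> nlinarith

/-- `f ↦ ‖f⁻‖²` is differentiable with derivative `-2 ⟪f⁻, ·⟫`. -/
theorem hasFDerivAt_norm_negL2_sq (f : G.L2) :
    HasFDerivAt (fun f : G.L2 => ‖negL2 f‖ ^ 2) ((-2 : ℝ) • innerSL ℝ (negL2 f)) f := by
  have h1 : ∀ h : G.L2, |‖negL2 (f + h)‖ ^ 2 - ‖negL2 f‖ ^ 2 + 2 * inner ℝ (negL2 f) h|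
      ≤ ‖h‖ ^ 2 := by
    intro h
    have h2 := ((hasSum_norm_sq (negL2 (f + h))).sub (hasSum_norm_sq (negL2 f))).add
      ((hasSum_inner (negL2 f) h).mul_left 2)
    have h3 : ∀ x, |G.m x * negL2 (f + h) x ^ 2 - G.m x * negL2 f x ^ 2 +
        2 * (G.m x * (negL2 f x * h x))| ≤ G.m x * h x ^ 2 := fun x => by
      have h4 := mul_le_mul_of_nonneg_left (sq_max_neg_expansion (f x) (h x)) (G.m_pos x).le
      rw [← abs_of_pos (G.m_pos x), ← abs_mul, abs_of_pos (G.m_pos x)] at h4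
      rw [negL2_apply, negL2_apply, coe_add, Pi.add_apply]
      convert! h4 using 2
      ring
    rw [abs_le]
    constructor
    · rw [← (hasSum_norm_sq h).tsum_eq, ← h2.tsum_eq, ← tsum_neg]
      exact (summable_sq h).neg.tsum_le_tsum (fun x => (abs_le.1 (h3 x)).1) h2.summable
    · rw [← (hasSum_norm_sq h).tsum_eq, ← h2.tsum_eq]
      exact h2.summable.tsum_le_tsum (fun x => (abs_le.1 (h3 x)).2) (summable_sq h)
  have h2 : HasFDerivAt (fun y : G.L2 => ‖negL2 y‖ ^ 2 - ‖negL2 f‖ ^ 2 +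
      2 * inner ℝ (negL2 f) (y - f)) (0 : G.L2 →L[ℝ] ℝ) f := by
    refine Asymptotics.IsBigO.hasFDerivAt (n := 2) ?_ one_lt_two
    refine Asymptotics.IsBigO.of_bound 1 (Eventually.of_forall fun y => ?_)
    have h3 := h1 (y - f)
    rw [add_sub_cancel] at h3
    rw [Real.norm_eq_abs, one_mul, Real.norm_of_nonneg (sq_nonneg _)]
    exact h3
  have h3 : HasFDerivAt (fun y : G.L2 => ‖negL2 f‖ ^ 2 + (-2 : ℝ) • innerSL ℝ (negL2 f) (y - f))
      ((-2 : ℝ) • innerSL ℝ (negL2 f)) f := by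
    have h4 : HasFDerivAt (fun y : G.L2 => y - f) (ContinuousLinearMap.id ℝ G.L2) f :=
      (hasFDerivAt_id f).sub_const f
    have h4 := ((innerSL ℝ (negL2 f)).hasFDerivAt.comp f h4).const_smul (-2 : ℝ)
    exact (h4.const_add (‖negL2 f‖ ^ 2)).congr_fderiv (by ext; simp)
  refine ((h2.add h3).congr_fderiv (zero_add _)).congr_of_eventuallyEq
    (Eventually.of_forall fun y => ?_)
  simp only [Pi.add_apply, innerSL_apply_apply, smul_eq_mul]
  ring

/-- The heat semigroup preserves positivity: `‖u⁻‖²` decreases along an orbit `u`, since its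
derivative is `2 Q(u, u⁻) ≤ 0`. -/
theorem orbit_nonneg (hG : G.Complete) {f f' : G.L2} (hf : (f, f') ∈ G.laplacianGraph)
    (hpos : ∀ x, 0 ≤ f x) {s : ℝ} (hs : 0 ≤ s) (x : V) : 0 ≤ G.heatSemigroup.orbit f s x := by
  have hT := heatSemigroup_hasGenerator hG
  set u := G.heatSemigroup.orbit f with hu
  have hcont : Continuous fun g : G.L2 => ‖negL2 g‖ ^ 2 :=
    continuous_iff_continuousAt.2 fun g => (hasFDerivAt_norm_negL2_sq g).continuousAt
  have hd : ∀ r : ℝ, 0 < r → HasDerivAt (fun r => ‖negL2 (u r)‖ ^ 2)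
      (-2 * inner ℝ (negL2 (u r)) (G.heatSemigroup.orbit f' r)) r := fun r hr =>
    (hasFDerivAt_norm_negL2_sq (u r)).comp_hasDerivAt r (hT.hasDerivAt_orbit hf hr)
  have hanti : AntitoneOn (fun r => ‖negL2 (u r)‖ ^ 2) (Set.Ici 0) := by
    refine antitoneOn_of_deriv_nonpos (convex_Ici 0)
      (hcont.comp (G.heatSemigroup.continuous_orbit' f)).continuousOn ?_ ?_
    · rw [interior_Ici]
      exact fun r hr => (hd r hr).differentiableAt.differentiableWithinAt
    · rw [interior_Ici]
      intro r hr
      rw [(hd r hr).deriv]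
      obtain ⟨h1, h2⟩ := mem_laplacianGraph_iff.1 (hT.orbit_mem hf r)
      have hcontr : ∀ a b : ℝ, |max (-a) 0 - max (-b) 0| ≤ |a - b| := fun a b => by
        refine (abs_max_sub_max_le_abs _ _ _).trans_eq ?_
        rw [neg_sub_neg, abs_sub_comm]
      have h3 : G.FiniteEnergy (negL2 (u r)) := h1.2.1.of_abs_sub_le fun x y => by
        rw [negL2_apply, negL2_apply]
        exact hcontr _ _
      have h4 := h2 _ (hG.coe_mem_formDomain_iff.2 h3)
      rw [← inner_eq_pairing, real_inner_comm] at h4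
      have h5 : G.energy (u r) (negL2 (u r)) ≤ 0 := by
        refine div_nonpos_of_nonpos_of_nonneg (tsum_nonpos fun p => ?_) zero_le_two
        rw [mul_assoc]
        refine mul_nonpos_of_nonneg_of_nonpos (G.μ_nonneg _ _) ?_
        rw [negL2_apply, negL2_apply]
        rcases le_total (u r p.1) (u r p.2) with h | h
        · exact mul_nonpos_of_nonneg_of_nonpos (sub_nonneg.2 h)
            (sub_nonpos.2 (max_le_max_right _ (neg_le_neg h)))
        · exact mul_nonpos_of_nonpos_of_nonneg (sub_nonpos.2 h)
            (sub_nonneg.2 (max_le_max_right _ (neg_le_neg h)))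
      linarith
  have h0 : negL2 (u 0) = 0 := ext_coe fun x => by
    rw [negL2_apply, hu, C0Semigroup.orbit_zero, coe_zero, Pi.zero_apply,
      max_eq_right (neg_nonpos.2 (hpos x))]
  have h1 := hanti (Set.mem_Ici.2 le_rfl) (Set.mem_Ici.2 hs) hs
  simp only [h0, norm_zero, ne_eq, OfNat.ofNat_ne_zero, not_false_eq_true, zero_pow] at h1
  have h2 : negL2 (u s) = 0 := by
    rw [← norm_eq_zero]
    nlinarith [norm_nonneg (negL2 (u s))]
  have h3 := negL2_apply (u s) x
  rw [h2, coe_zero, Pi.zero_apply] at h3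
  by_contra hn
  rw [max_eq_left (by linarith)] at h3
  linarith

theorem inner_laplacian_comm {f f' g g' : G.L2} (hf : (f, f') ∈ G.laplacianGraph)
    (hg : (g, g') ∈ G.laplacianGraph) : inner ℝ f' g = inner ℝ f g' := by
  have h1 := (mem_laplacianGraph_iff.1 hf).2 g hg.1
  have h2 := (mem_laplacianGraph_iff.1 hg).2 f hf.1
  rw [← inner_eq_pairing] at h1 h2
  rw [energy_comm, h1, real_inner_comm f g'] at h2
  linarith

theorem inner_orbit_le (hG : G.Complete) {f f' g g' : G.L2} (hf : (f, f') ∈ G.laplacianGraph)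
    (hg : (g, g') ∈ G.laplacianGraph) {t : ℝ} (ht : 0 ≤ t) :
    inner ℝ (G.heatSemigroup.orbit f t) g ≤ inner ℝ f (G.heatSemigroup.orbit g t) := by
  have hT := heatSemigroup_hasGenerator hG
  set T := G.heatSemigroup with hT'
  have hd : ∀ s ∈ Set.Ioo 0 t, HasDerivAt
      (fun s => inner ℝ (T.orbit f (t - s)) (T.orbit g s)) 0 s := by
    intro s hs
    have h1 : HasDerivAt (fun s => T.orbit f (t - s)) (-T.orbit f' (t - s)) s := by
      have := (hT.hasDerivAt_orbit hf (sub_pos.2 hs.2)).scomp s ((hasDerivAt_id s).const_sub t)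
      exact this.congr_deriv (by simp)
    refine (h1.inner ℝ (hT.hasDerivAt_orbit hg hs.1)).congr_deriv ?_
    rw [inner_neg_left, inner_laplacian_comm (hT.orbit_mem hf (t - s)) (hT.orbit_mem hg s)]
    ring
  have hmono : MonotoneOn (fun s => inner ℝ (T.orbit f (t - s)) (T.orbit g s)) (Set.Icc 0 t) := by
    refine monotoneOn_of_deriv_nonneg (convex_Icc 0 t) (Continuous.continuousOn ?_) ?_ ?_
    · exact ((T.continuous_orbit' f).comp (continuous_sub_left t)).inner (T.continuous_orbit' g)
    · rw [interior_Icc]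
      exact fun s hs => (hd s hs).differentiableAt.differentiableWithinAt
    · rw [interior_Icc]
      exact fun s hs => (hd s hs).deriv.ge
  simpa [C0Semigroup.orbit_zero] using
    hmono (Set.left_mem_Icc.2 ht) (Set.right_mem_Icc.2 ht) ht

/-- The heat semigroup is symmetric. -/
theorem inner_orbit_comm (hG : G.Complete) {f f' g g' : G.L2} (hf : (f, f') ∈ G.laplacianGraph)
    (hg : (g, g') ∈ G.laplacianGraph) {t : ℝ} (ht : 0 ≤ t) :
    inner ℝ (G.heatSemigroup.orbit f t) g = inner ℝ f (G.heatSemigroup.orbit g t) := by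
  refine le_antisymm (inner_orbit_le hG hf hg ht) ?_
  rw [real_inner_comm, real_inner_comm g]
  exact inner_orbit_le hG hg hf ht

end WeightedGraph

/-! ### Subsolutions and their weak form -/

namespace WeightedGraph

variable {V : Type*} {G : WeightedGraph V}

/-- The energy of `φ w` is controlled by `Q(w, φ² w)` and `Γ(φ)`, for a finitely supported `φ`:
this is the identity
`(q - p) (b² q - a² p) = (b q - a p)² - p q (b - a)²`, in which the last term is estimated by
`2 p q ≤ p² + q²`. -/
theorem caccioppoli {w φ : V → ℝ} {C : ℝ} (hφ : (Function.support φ).Finite)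
    (hC : ∀ x, G.gamma φ x ≤ C) (hw : Summable fun x => G.m x * w x ^ 2) :
    ∑' p : V × V, G.μ p.1 p.2 * ((φ * w) p.2 - (φ * w) p.1) ^ 2 ≤
      2 * G.energy w (φ * (φ * w)) + 2 * C * ∑' x, G.m x * w x ^ 2 := by
  obtain ⟨h1, h2⟩ := hasSum_sq_mul_grad hC hw
  set A : V × V → ℝ := fun p => G.μ p.1 p.2 * w p.1 ^ 2 * (φ p.2 - φ p.1) ^ 2 with hA
  have h3 : HasSum (fun p : V × V => A p.swap) (∑' p, A p) :=
    (Equiv.prodComm V V).hasSum_iff.2 h1.hasSum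
  have h4 : Summable fun p : V × V =>
      G.μ p.1 p.2 * (w p.2 - w p.1) * ((φ * (φ * w)) p.2 - (φ * (φ * w)) p.1) := by
    refine G.summable_of_finite hφ fun p hp => ⟨fun h => hp (by rw [h]; ring), ?_⟩
    by_contra hn
    simp only [Function.mem_support, not_or, not_not] at hn
    exact hp (by simp [hn.1, hn.2])
  have h5 := (h4.hasSum.add (h1.hasSum.div_const 2)).add (h3.div_const 2)
  refine (Summable.tsum_le_tsum (fun p => ?_) (finiteEnergy_of_finite
    (hφ.subset (Function.support_mul_subset_left _ _))) h5.summable).trans ?_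
  · have h7 := mul_nonneg (G.μ_nonneg p.1 p.2)
      (mul_nonneg (sq_nonneg (φ p.2 - φ p.1)) (sq_nonneg (w p.2 - w p.1)))
    simp only [hA, Prod.fst_swap, Prod.snd_swap, Pi.mul_apply, G.μ_symm p.2 p.1]
    linear_combination h7 / 2
  · rw [h5.tsum_eq]
    unfold energy
    linarith

theorem IsCutoff.tendsto_mul {η : ℕ → V → ℝ} (hη : G.IsCutoff η) (f : V → ℝ) (x : V) :
    Tendsto (fun k => η k x * f x) atTop (𝓝 (f x)) := by
  simpa using (hη.tendsto x).mul_const (f x)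

/-- A bounded, nonnegative, square integrable subsolution `Δ w ≥ h` with `h ∈ ℓ¹` has finite energy,
by testing with `η_k² w`. -/
theorem IsCutoff.finiteEnergy_of_le_lap {η : ℕ → V → ℝ} (hη : G.IsCutoff η) {w h : V → ℝ} {C : ℝ}
    (hw0 : ∀ x, 0 ≤ w x) (hwC : ∀ x, w x ≤ C) (hw : Summable fun x => G.m x * w x ^ 2)
    (hh : Summable fun x => G.m x * |h x|) (hle : ∀ x, h x ≤ G.lap w x) : G.FiniteEnergy w := by
  have h1 : ∀ k, G.energy w (η k * (η k * w)) ≤ C * ∑' x, G.m x * |h x| := by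
    intro k
    have h2 := hasSum_green_right (G := G) (w := w) (hη.finite_mul (η k * w) k)
    rw [← neg_neg (G.energy w _), ← h2.tsum_eq, ← tsum_mul_left, ← tsum_neg]
    refine h2.summable.neg.tsum_le_tsum (fun x => ?_) (hh.mul_left C)
    have h3 : 0 ≤ η k x * (η k x * w x) :=
      mul_nonneg (hη.nonneg k x) (mul_nonneg (hη.nonneg k x) (hw0 x))
    have h4 : η k x * (η k x * w x) ≤ C := by
      refine le_trans ?_ (hwC x)
      refine (mul_le_of_le_one_left (mul_nonneg (hη.nonneg k x) (hw0 x)) (hη.le_one k x)).trans ?_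
      exact mul_le_of_le_one_left (hw0 x) (hη.le_one k x)
    have h5 : -G.lap w x ≤ |h x| := (neg_le_neg (hle x)).trans (neg_le_abs _)
    have h6 := mul_le_mul_of_nonneg_right h5 h3
    have h7 := mul_le_mul_of_nonneg_left h4 (abs_nonneg (h x))
    have h8 := mul_le_mul_of_nonneg_left (h6.trans h7) (G.m_pos x).le
    simp only [Pi.mul_apply]
    linarith
  set B := 2 * (C * ∑' x, G.m x * |h x|) + 2 * 1 * ∑' x, G.m x * w x ^ 2 with hB
  have h2 : ∀ k, ∑' p : V × V, G.μ p.1 p.2 * ((η k * w) p.2 - (η k * w) p.1) ^ 2 ≤ B := fun k => by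
    have h3 := caccioppoli (hη.finite k) (C := 1) (fun x => (hη.gamma_le k x).trans
      (div_le_one_of_le₀ (by linarith [k.cast_nonneg (α := ℝ)]) (by positivity))) hw
    linarith [h1 k]
  refine summable_of_sum_le (c := B) (fun p => mul_nonneg (G.μ_nonneg _ _) (sq_nonneg _))
    fun u => ?_
  have h3 : Tendsto (fun k => ∑ p ∈ u, G.μ p.1 p.2 * ((η k * w) p.2 - (η k * w) p.1) ^ 2) atTop
      (𝓝 (∑ p ∈ u, G.μ p.1 p.2 * (w p.2 - w p.1) ^ 2)) := by
    refine tendsto_finsetSum _ fun p _ => ?_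
    have h4 := (((hη.tendsto_mul w p.2).sub (hη.tendsto_mul w p.1)).pow 2).const_mul (G.μ p.1 p.2)
    exact h4
  refine le_of_tendsto h3 (Eventually.of_forall fun k => le_trans ?_ (h2 k))
  exact (finiteEnergy_of_finite (hη.finite_mul w k)).sum_le_tsum u
    fun p _ => mul_nonneg (G.μ_nonneg _ _) (sq_nonneg _)

variable [MeasurableSpace V] [DiscreteMeasurableSpace V]

/-- `ℓ²(V, m)` is contained in `ℓ^∞` when `m` is bounded below. -/
theorem NonDegenerate.exists_bound (hm : G.NonDegenerate) :
    ∃ D : ℝ, 0 ≤ D ∧ ∀ (f : G.L2) (x : V), |f x| ≤ D * ‖f‖ := by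
  obtain ⟨δ, hδ, h⟩ := hm
  refine ⟨(√δ)⁻¹, by positivity, fun f x => ?_⟩
  have h1 := m_mul_sq_le f x
  rw [inv_mul_eq_div, le_div_iff₀ (Real.sqrt_pos.2 hδ)]
  refine abs_le_of_sq_le_sq' ?_ (norm_nonneg f) |>.2
  rw [mul_pow, Real.sq_sqrt hδ.le, sq_abs, mul_comm]
  exact (mul_le_mul_of_nonneg_right (h x) (sq_nonneg _)).trans h1

/-- The weak form of a pointwise inequality `Δ w ≥ h`: it may be tested against a nonnegative
function in the domain of `L`, which is approximated by its products with the cut-off functions. -/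
theorem IsCutoff.tsum_le_inner {η : ℕ → V → ℝ} (hη : G.IsCutoff η) (hm : G.NonDegenerate)
    {w g g' : G.L2} {h : V → ℝ} (hwD : ⇑w ∈ G.formDomain)
    (hh : Summable fun x => G.m x * |h x|) (hle : ∀ x, h x ≤ G.lap w x)
    (hg : (g, g') ∈ G.laplacianGraph) (hg0 : ∀ x, 0 ≤ g x) :
    ∑' x, G.m x * (h x * g x) ≤ inner ℝ g' w := by
  obtain ⟨hg1, hg2⟩ := mem_laplacianGraph_iff.1 hg
  have hw : G.FiniteEnergy w := hwD.2.1
  obtain ⟨D, hD, hbd⟩ := hm.exists_bound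
  have h1 := hη.tendsto_energy (summable_sq g) hg1.2.1
  have h2 : Tendsto (fun k => G.energy w (η k * ⇑g)) atTop (𝓝 (G.energy w g)) := by
    rw [tendsto_iff_dist_tendsto_zero]
    have h3 : Tendsto (fun k => √(G.energy w w * G.energy (η k * ⇑g - ⇑g) (η k * ⇑g - ⇑g)))
        atTop (𝓝 0) := by
      simpa using (h1.const_mul (G.energy w w)).sqrt
    refine squeeze_zero (fun _ => dist_nonneg) (fun k => ?_) h3
    have h4 : G.FiniteEnergy (η k * ⇑g) := finiteEnergy_of_finite (hη.finite_mul _ k)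
    rw [Real.dist_eq, energy_comm, energy_comm (⇑w) (⇑g), ← energy_sub_left h4 hg1.2.1 hw,
      energy_comm]
    exact Real.abs_le_sqrt (sq_energy_le hw (h4.sub hg1.2.1))
  have h3 : Tendsto (fun k => ∑' x, G.m x * (h x * (η k x * g x))) atTop
      (𝓝 (∑' x, G.m x * (h x * g x))) := by
    refine tendsto_tsum_of_dominated_convergence (bound := fun x => D * ‖g‖ * (G.m x * |h x|))
      (hh.mul_left _) (fun x => ?_) (Eventually.of_forall fun k x => ?_)
    · exact ((hη.tendsto_mul g x).const_mul (h x)).const_mul (G.m x)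
    · rw [Real.norm_eq_abs, abs_mul, abs_mul, abs_of_pos (G.m_pos x), abs_mul,
        abs_of_nonneg (hη.nonneg k x)]
      have h4 : η k x * |g x| ≤ D * ‖g‖ :=
        (mul_le_of_le_one_left (abs_nonneg _) (hη.le_one k x)).trans (hbd g x)
      have h5 := mul_le_mul_of_nonneg_left (mul_le_mul_of_nonneg_left h4 (abs_nonneg (h x)))
        (G.m_pos x).le
      linarith
  have h4 : inner ℝ g' w = -G.energy w g := by
    rw [energy_comm, hg2 _ hwD, neg_neg, inner_eq_pairing]
  rw [h4]
  refine le_of_tendsto_of_tendsto' h3 h2.neg fun k => ?_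
  have h5 := hasSum_green_right (G := G) (w := w) (hη.finite_mul g k)
  rw [← h5.tsum_eq]
  refine Summable.tsum_le_tsum (fun x => ?_) ?_ h5.summable
  · rw [mul_assoc]
    exact mul_le_mul_of_nonneg_left (mul_le_mul_of_nonneg_right (hle x)
      (mul_nonneg (hη.nonneg k x) (hg0 x))) (G.m_pos x).le
  · refine summable_of_hasFiniteSupport ((hη.finite k).subset fun x hx hx' => hx ?_)
    simp [hx']

end WeightedGraph

/-! ### `Γ` as a bounded form, and the gradient along the heat flow -/

namespace WeightedGraph

variable {V : Type*} {G : WeightedGraph V}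

theorem sq_gammaForm_le (f g : V → ℝ) (x : V) :
    G.gammaForm f g x ^ 2 ≤ G.gamma f x * G.gamma g x := by
  have h1 := (inv_pos.2 (G.m_pos x)).le
  have h0 : ∀ f : V → ℝ, ∀ y ∈ G.nbrs x, 0 ≤ G.μ x y * (f y - f x) * (f y - f x) / 2 :=
    fun f y _ => by
      rw [mul_assoc]
      exact div_nonneg (mul_nonneg (G.μ_nonneg x y) (mul_self_nonneg _)) zero_le_two
  have h2 := Finset.sum_sq_le_sum_mul_sum_of_sq_le_mul (G.nbrs x) (h0 f) (h0 g)
    (r := fun y => G.μ x y * (f y - f x) * (g y - g x) / 2) (fun y _ => le_of_eq (by ring))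
  rw [gamma, gamma, gammaForm_eq, gammaForm_eq, gammaForm_eq]
  have h3 := mul_le_mul_of_nonneg_left h2 (mul_nonneg h1 h1)
  linear_combination h3

theorem FiniteEnergy.m_mul_gamma_le {f : V → ℝ} (hf : G.FiniteEnergy f) (x : V) :
    G.m x * G.gamma f x ≤ G.energy f f :=
  le_hasSum (hf.hasSum_gammaForm hf) x fun y _ => mul_nonneg (G.m_pos y).le (G.gamma_nonneg f y)

/-- `Γ(f, g) ∈ ℓ²` with `‖Γ(f, g)‖² ≤ δ⁻¹ Q(f) Q(g)` when `m ≥ δ`. -/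
theorem FiniteEnergy.gammaForm_sq_bound {δ : ℝ} (hδ : 0 < δ) (hm : ∀ x, δ ≤ G.m x) {f g : V → ℝ}
    (hf : G.FiniteEnergy f) (hg : G.FiniteEnergy g) :
    Summable (fun x => G.m x * G.gammaForm f g x ^ 2) ∧
      ∑' x, G.m x * G.gammaForm f g x ^ 2 ≤ δ⁻¹ * (G.energy f f * G.energy g g) := by
  have h1 : ∀ x, G.m x * G.gammaForm f g x ^ 2 ≤
      δ⁻¹ * (G.energy f f * (G.m x * G.gammaForm g g x)) := fun x => by
    rw [inv_mul_eq_div, le_div_iff₀ hδ]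
    have hmx := (G.m_pos x).le
    have h2 := mul_le_mul_of_nonneg_left (sq_gammaForm_le (G := G) f g x) (mul_nonneg hmx hmx)
    have h3 := mul_le_mul_of_nonneg_right (hf.m_mul_gamma_le x)
      (mul_nonneg hmx (G.gamma_nonneg g x))
    have h4 := mul_le_mul_of_nonneg_left (hm x) (mul_nonneg hmx (sq_nonneg (G.gammaForm f g x)))
    unfold gamma at h2 h3
    linarith
  have h2 := ((hg.hasSum_gammaForm hg).mul_left (G.energy f f)).mul_left δ⁻¹
  have h3 := Summable.of_nonneg_of_le (fun x => mul_nonneg (G.m_pos x).le (sq_nonneg _)) h1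
    h2.summable
  refine ⟨h3, ?_⟩
  rw [← h2.tsum_eq]
  exact h3.tsum_le_tsum h1 h2.summable

variable [MeasurableSpace V] [DiscreteMeasurableSpace V]

theorem FiniteEnergy.memLp_gamma (hm : G.NonDegenerate) {f : V → ℝ} (hf : G.FiniteEnergy f) :
    MemLp (G.gamma f) 2 G.vertexMeasure := by
  obtain ⟨δ, hδ, hm⟩ := hm
  exact memLp_two_iff.2 (hf.gammaForm_sq_bound hδ hm hf).1

theorem NonDegenerate.exists_mulEdge_bound (hm : G.NonDegenerate) :
    ∃ D : ℝ, 0 ≤ D ∧ ∀ (g : G.L2) (F : EdgeL2 V), ∃ h : Memℓp (fun p => g p.1 * F p) 2,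
      ‖(⟨fun p => g p.1 * F p, h⟩ : EdgeL2 V)‖ ≤ D * ‖g‖ * ‖F‖ := by
  obtain ⟨D, hD, hb⟩ := hm.exists_bound
  refine ⟨D, hD, fun g F => ?_⟩
  have hF := memlp_two_iff.1 (lp.memℓp F)
  have h1 : ∀ p : V × V, (g p.1 * F p) ^ 2 ≤ (D * ‖g‖) ^ 2 * F p ^ 2 := fun p => by
    rw [mul_pow]
    exact mul_le_mul_of_nonneg_right (sq_le_sq.2 ((hb g p.1).trans (le_abs_self _))) (sq_nonneg _)
  have h2 : Summable fun p : V × V => (g p.1 * F p) ^ 2 :=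
    Summable.of_nonneg_of_le (fun p => sq_nonneg _) h1 (hF.mul_left _)
  refine ⟨memlp_two_iff.2 h2, ?_⟩
  have hn : ∀ F : EdgeL2 V, ‖F‖ ^ 2 = ∑' p, F p ^ 2 := fun F => by
    rw [← real_inner_self_eq_norm_sq, lp.inner_eq_tsum]
    simp [sq]
  refine (pow_le_pow_iff_left₀ (norm_nonneg _) (by positivity) two_ne_zero).1 ?_
  rw [mul_pow _ ‖F‖, hn, hn, ← tsum_mul_left]
  exact h2.tsum_le_tsum h1 (hF.mul_left _)

/-- Multiplication of functions of pairs `(x, y)` by `g x`, for `g ∈ ℓ²(V, m)`; it is bounded as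
`ℓ² ⊆ ℓ^∞` for a non-degenerate measure. -/
noncomputable def mulEdge (hm : G.NonDegenerate) : G.L2 →L[ℝ] EdgeL2 V →L[ℝ] EdgeL2 V :=
  LinearMap.mkContinuous₂
    (LinearMap.mk₂ ℝ (fun g F => (⟨fun p => g p.1 * F p,
        (hm.exists_mulEdge_bound.choose_spec.2 g F).choose⟩ : EdgeL2 V))
      (fun g g' F => by
        ext p
        change (g + g') p.1 * F p = g p.1 * F p + g' p.1 * F p
        rw [coe_add, Pi.add_apply, add_mul])
      (fun c g F => by
        ext p
        change (c • g) p.1 * F p = c * (g p.1 * F p)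
        rw [coe_smul, Pi.smul_apply, smul_eq_mul, mul_assoc])
      (fun g F F' => by
        ext p
        exact mul_add _ _ _)
      (fun c g F => by
        ext p
        exact mul_left_comm _ _ _))
    hm.exists_mulEdge_bound.choose fun g F =>
      (hm.exists_mulEdge_bound.choose_spec.2 g F).choose_spec

theorem mulEdge_apply (hm : G.NonDegenerate) (g : G.L2) (F : EdgeL2 V) (p : V × V) :
    mulEdge hm g F p = g p.1 * F p := rfl

theorem hasSum_inner_mulEdge (hm : G.NonDegenerate) {u v : V → ℝ} (hu : G.FiniteEnergy u)
    (hv : G.FiniteEnergy v) (g : G.L2) :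
    HasSum (fun x => G.m x * (G.gammaForm u v x * g x))
      (inner ℝ (grad u hu) (mulEdge hm g (grad v hv)) / 2) := by
  refine ((lp.hasSum_inner (grad u hu) (mulEdge hm g (grad v hv))).div_const 2).prod_fiberwise
    fun x => ?_
  rw [← mul_assoc]
  refine ((hasSum_fiber (f := u) (g := v) x).mul_right (g x)).congr_fun fun y => ?_
  rw [mulEdge_apply, grad_apply, grad_apply]
  simp only [RCLike.inner_apply, conj_trivial]
  have h := Real.mul_self_sqrt (G.μ_nonneg x y)
  linear_combination (g x * (u y - u x) * (v y - v x) / 2) * h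

theorem inner_mulEdge_comm (hm : G.NonDegenerate) (g : G.L2) (F F' : EdgeL2 V) :
    inner ℝ F (mulEdge hm g F') = inner ℝ F' (mulEdge hm g F) := by
  rw [lp.inner_eq_tsum, lp.inner_eq_tsum]
  refine tsum_congr fun p => ?_
  rw [mulEdge_apply, mulEdge_apply]
  simp only [RCLike.inner_apply, conj_trivial]
  ring

theorem finiteEnergy_resolvent (hG : G.Complete) (h : G.L2) :
    G.FiniteEnergy (DissipativeRelation.resolvent (isMDissipative hG) one_pos h) :=
  (mem_laplacianGraph_iff.1 (DissipativeRelation.resolvent_mem (isMDissipative hG) one_pos h)).1.2.1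

/-- The operator `d (1 - L)⁻¹`, which is bounded since `Q(f) ≤ ‖f - L f‖²`. It is used to
differentiate `d P_t f` in `t`. -/
noncomputable def gradResolvent (hG : G.Complete) : G.L2 →L[ℝ] EdgeL2 V :=
  LinearMap.mkContinuous
    { toFun := fun h => grad _ (finiteEnergy_resolvent hG h)
      map_add' := fun h h' => by
        ext p
        rw [lp.coeFn_add, Pi.add_apply, grad_apply, grad_apply, grad_apply, map_add, coe_add,
          Pi.add_apply, Pi.add_apply]
        ring
      map_smul' := fun c h => by
        ext p
        rw [lp.coeFn_smul, Pi.smul_apply, grad_apply, grad_apply, map_smul, coe_smul,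
          Pi.smul_apply, Pi.smul_apply, smul_eq_mul, smul_eq_mul, smul_eq_mul, RingHom.id_apply]
        ring }
    (√2) fun h => by
      set R := DissipativeRelation.resolvent (isMDissipative hG) one_pos with hR
      have h1 := energy_eq_of_mem_laplacianGraph
        (DissipativeRelation.resolvent_mem (isMDissipative hG) one_pos h)
      have h2 := DissipativeRelation.yosida_eq (isMDissipative hG) one_pos h
      rw [one_smul] at h2
      rw [h2, ← hR, inner_sub_left, real_inner_self_eq_norm_sq] at h1
      have h3 := real_inner_le_norm h (R h)
      have h4 := DissipativeRelation.norm_resolvent_apply_le (isMDissipative hG) one_pos h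
      have h5 : ‖grad _ (finiteEnergy_resolvent hG h)‖ ^ 2 = _ := norm_grad_sq _
      change ‖grad _ (finiteEnergy_resolvent hG h)‖ ≤ √2 * ‖h‖
      refine (pow_le_pow_iff_left₀ (norm_nonneg _) (by positivity) two_ne_zero).1 ?_
      rw [h5, mul_pow, Real.sq_sqrt zero_le_two, h1]
      rw [← hR] at h4
      nlinarith [norm_nonneg h, norm_nonneg (R h)]

theorem gradResolvent_sub (hG : G.Complete) {f g : G.L2} (h : (f, g) ∈ G.laplacianGraph) :
    gradResolvent hG (f - g) = grad f h.1.2.1 := by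
  have h1 : DissipativeRelation.resolvent (isMDissipative hG) one_pos (f - g) = f :=
    DissipativeRelation.resolvent_apply_eq (isMDissipative hG) one_pos (p := (f, g)) h
      (by rw [one_smul])
  ext p
  change grad _ (finiteEnergy_resolvent hG (f - g)) p = _
  rw [grad_apply, grad_apply, h1]

theorem hasDerivAt_gradResolvent_orbit (hG : G.Complete) {f g : G.L2}
    (h : (f, g) ∈ G.laplacianGraph) {s : ℝ} (hs : 0 < s) :
    HasDerivAt (fun s => gradResolvent hG (G.heatSemigroup.orbit f s))
      (gradResolvent hG (G.heatSemigroup.orbit g s)) s :=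
  (gradResolvent hG).hasFDerivAt.comp_hasDerivAt s
    ((heatSemigroup_hasGenerator hG).hasDerivAt_orbit h hs)

end WeightedGraph

/-! ### From the curvature condition to the gradient bound -/

/-- The derivative of a quadratic form `⟪u, M(g) u⟫` along a curve `(u, g)`. -/
theorem hasDerivAt_inner_clm_apply {E X : Type*} [NormedAddCommGroup E] [InnerProductSpace ℝ E]
    [NormedAddCommGroup X] [NormedSpace ℝ X] (M : X →L[ℝ] E →L[ℝ] E)
    (hM : ∀ x u v, inner ℝ u (M x v) = inner ℝ v (M x u)) {u : ℝ → E} {g : ℝ → X} {u' : E} {g' : X}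
    {s : ℝ} (hu : HasDerivAt u u' s) (hg : HasDerivAt g g' s) :
    HasDerivAt (fun s => inner ℝ (u s) (M (g s) (u s)))
      (inner ℝ (u s) (M g' (u s)) + 2 * inner ℝ (u s) (M (g s) u')) s := by
  have h1 : HasDerivAt (fun s => M (g s)) (M g') s := M.hasFDerivAt.comp_hasDerivAt s hg
  refine (hu.inner ℝ (h1.clm_apply hu)).congr_deriv ?_
  rw [inner_add_right, hM _ u']
  ring

namespace WeightedGraph

variable {V : Type*} {G : WeightedGraph V}

theorem summable_abs_gammaForm {u v : V → ℝ} (hu : G.FiniteEnergy u) (hv : G.FiniteEnergy v) :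
    Summable fun x => G.m x * |G.gammaForm u v x| :=
  (hu.hasSum_gammaForm hv).summable.abs.congr fun x => by rw [abs_mul, abs_of_pos (G.m_pos x)]

theorem FiniteEnergy.gamma_le_of_nonDegenerate {δ : ℝ} (hδ : 0 < δ) (hm : ∀ x, δ ≤ G.m x)
    {f : V → ℝ} (hf : G.FiniteEnergy f) (x : V) : G.gamma f x ≤ G.energy f f / δ := by
  rw [le_div_iff₀ hδ, mul_comm]
  exact (mul_le_mul_of_nonneg_right (hm x) (G.gamma_nonneg f x)).trans (hf.m_mul_gamma_le x)

variable [MeasurableSpace V]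

theorem heat_eq_orbit (t : ℝ≥0) {f : V → ℝ} (hf : MemLp f 2 G.vertexMeasure) :
    G.heat t f hf = G.heatSemigroup.orbit (hf.toLp f) t := by
  rw [C0Semigroup.orbit_coe, heat]

variable [DiscreteMeasurableSpace V]

/-- The curvature condition in weak form, `½ ⟪Γ(u), L g⟫ - ⟪Γ(u, L u), g⟫ ≥ K ⟪Γ(u), g⟫` for
`g ≥ 0` in the domain of `L`. By `CD(K, ∞)`, `Γ(u) ∈ ℓ¹` is a subsolution,
`Δ Γ(u) ≥ 2 K Γ(u) + 2 Γ(u, L u) ∈ ℓ¹`, and so it has finite energy. -/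
theorem CD.weak (hG : G.Complete) (hm : G.NonDegenerate) {K : ℝ} (hCD : G.CD K) {u u' g g' : G.L2}
    (hu : (u, u') ∈ G.laplacianGraph) (hu' : G.FiniteEnergy u')
    (hg : (g, g') ∈ G.laplacianGraph) (hg0 : ∀ x, 0 ≤ g x) :
    2 * K * ∑' x, G.m x * (G.gamma u x * g x) + 2 * ∑' x, G.m x * (G.gammaForm u u' x * g x) ≤
      ∑' x, G.m x * (G.gamma u x * g' x) := by
  obtain ⟨η, hη⟩ := hG.exists_isCutoff
  have huE : G.FiniteEnergy u := hu.1.2.1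
  set h : V → ℝ := fun x => 2 * K * G.gamma u x + 2 * G.gammaForm u u' x with hh
  have hΓ : MemLp (G.gamma u) 2 G.vertexMeasure := huE.memLp_gamma hm
  set w : G.L2 := hΓ.toLp with hw
  have hwu : ⇑w = G.gamma u := coe_toLp hΓ
  have hle : ∀ x, h x ≤ G.lap w x := fun x => by
    have h1 := hCD u x
    have h2 : G.lap u = u' := funext fun x => (eq_lap_of_mem_laplacianGraph hu x).symm
    rw [gammaTwo, gammaTwoForm, h2] at h1
    rw [hwu, hh]
    change _ ≤ G.lap (G.gammaForm u u) x
    linarith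
  have hh1 : Summable fun x => G.m x * |h x| := by
    refine Summable.of_nonneg_of_le (fun x => mul_nonneg (G.m_pos x).le (abs_nonneg _))
      (fun x => ?_) (((summable_abs_gammaForm huE huE).mul_left |2 * K|).add
        ((summable_abs_gammaForm huE hu').mul_left 2))
    have h1 := abs_add_le (2 * K * G.gamma u x) (2 * G.gammaForm u u' x)
    rw [abs_mul (2 * K), abs_mul 2 (G.gammaForm u u' x), abs_two] at h1
    have h2 := mul_le_mul_of_nonneg_left h1 (G.m_pos x).le
    change _ ≤ |2 * K| * (G.m x * |G.gamma u x|) + _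
    linarith
  have hwE : G.FiniteEnergy w := by
    obtain ⟨δ, hδ, hδm⟩ := hm
    refine hη.finiteEnergy_of_le_lap (C := G.energy u u / δ) (fun x => ?_) (fun x => ?_)
      (summable_sq w) hh1 hle
    · rw [hwu]; exact G.gamma_nonneg _ x
    · rw [hwu]; exact huE.gamma_le_of_nonDegenerate hδ hδm x
  have key := hη.tsum_le_inner hm (hG.coe_mem_formDomain_iff.2 hwE) hh1 hle hg hg0
  have h1 := (hasSum_inner_mulEdge hm huE huE g).summable
  have h2 := (hasSum_inner_mulEdge hm huE hu' g).summable
  have h3 := ((h1.hasSum.mul_left (2 * K)).add (h2.hasSum.mul_left 2)).tsum_eq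
  have h4 := (hasSum_inner w g').tsum_eq
  rw [hwu, ← real_inner_comm] at h4
  rw [h4]
  change 2 * K * ∑' x, G.m x * (G.gammaForm u u x * g x) + _ ≤ _
  rw [← h3]
  refine le_trans (le_of_eq (tsum_congr fun x => ?_)) key
  rw [hh]
  change 2 * K * (G.m x * (G.gamma u x * g x)) + _ = _
  ring

/-- `⟪Γ(P_{t-s} f), P_s g⟫` in terms of the gradient of `P_{t-s} f`. -/
theorem tsum_gamma_orbit_eq (hG : G.Complete) (hm : G.NonDegenerate) {f f₁ : G.L2}
    (hf : (f, f₁) ∈ G.laplacianGraph) (g : G.L2) (r s : ℝ) :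
    ∑' y, G.m y * (G.gamma (G.heatSemigroup.orbit f r) y * G.heatSemigroup.orbit g s y) =
      inner ℝ (gradResolvent hG (G.heatSemigroup.orbit (f - f₁) r))
        (mulEdge hm (G.heatSemigroup.orbit g s)
          (gradResolvent hG (G.heatSemigroup.orbit (f - f₁) r))) / 2 := by
  have hr := (heatSemigroup_hasGenerator hG).orbit_mem hf r
  rw [C0Semigroup.orbit_sub, gradResolvent_sub hG hr]
  exact (hasSum_inner_mulEdge hm hr.1.2.1 hr.1.2.1 _).tsum_eq

theorem continuous_tsum_gamma_orbit (hG : G.Complete) (hm : G.NonDegenerate) {f f₁ : G.L2}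
    (hf : (f, f₁) ∈ G.laplacianGraph) (g : G.L2) (t : ℝ) :
    Continuous fun s => ∑' y, G.m y *
      (G.gamma (G.heatSemigroup.orbit f (t - s)) y * G.heatSemigroup.orbit g s y) := by
  simp only [tsum_gamma_orbit_eq hG hm hf]
  have h1 : Continuous fun s =>
      gradResolvent hG (G.heatSemigroup.orbit (f - f₁) (t - s)) :=
    (gradResolvent hG).continuous.comp
      ((G.heatSemigroup.continuous_orbit' _).comp (continuous_sub_left t))
  have h2 : Continuous fun s => mulEdge hm (G.heatSemigroup.orbit g s) :=
    (mulEdge hm).continuous.comp (G.heatSemigroup.continuous_orbit' g)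
  exact (h1.inner (h2.clm_apply h1)).div_const 2

/-- The derivative of `⟪Γ(P_{t-s} f), P_s g⟫` in `s`, for `f` in the domain of `L²` and `g` in
the domain of `L`. -/
theorem hasDerivAt_tsum_gamma_orbit (hG : G.Complete) (hm : G.NonDegenerate)
    {f f₁ f₂ g g' : G.L2} (hf : (f, f₁) ∈ G.laplacianGraph) (hf₁ : (f₁, f₂) ∈ G.laplacianGraph)
    (hg : (g, g') ∈ G.laplacianGraph) {s t : ℝ} (hs : s ∈ Set.Ioo 0 t) :
    HasDerivAt (fun s => ∑' y, G.m y *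
        (G.gamma (G.heatSemigroup.orbit f (t - s)) y * G.heatSemigroup.orbit g s y))
      (∑' y, G.m y *
          (G.gamma (G.heatSemigroup.orbit f (t - s)) y * G.heatSemigroup.orbit g' s y) -
        2 * ∑' y, G.m y * (G.gammaForm (G.heatSemigroup.orbit f (t - s))
          (G.heatSemigroup.orbit f₁ (t - s)) y * G.heatSemigroup.orbit g s y)) s := by
  have hT := heatSemigroup_hasGenerator hG
  have hab : (f - f₁, f₁ - f₂) ∈ G.laplacianGraph := sub_mem_laplacianGraph hG hf hf₁
  have e : ∑' y, G.m y * (G.gammaForm (G.heatSemigroup.orbit f (t - s))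
      (G.heatSemigroup.orbit f₁ (t - s)) y * G.heatSemigroup.orbit g s y) =
      inner ℝ (gradResolvent hG (G.heatSemigroup.orbit (f - f₁) (t - s)))
        (mulEdge hm (G.heatSemigroup.orbit g s)
          (gradResolvent hG (G.heatSemigroup.orbit (f₁ - f₂) (t - s)))) / 2 := by
    rw [C0Semigroup.orbit_sub, gradResolvent_sub hG (hT.orbit_mem hf (t - s)),
      C0Semigroup.orbit_sub, gradResolvent_sub hG (hT.orbit_mem hf₁ (t - s))]
    exact (hasSum_inner_mulEdge hm _ _ _).tsum_eq
  simp only [tsum_gamma_orbit_eq hG hm hf, e]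
  have h1 : HasDerivAt (fun s => gradResolvent hG (G.heatSemigroup.orbit (f - f₁) (t - s)))
      ((-1 : ℝ) • gradResolvent hG (G.heatSemigroup.orbit (f₁ - f₂) (t - s))) s :=
    (hasDerivAt_gradResolvent_orbit hG hab (sub_pos.2 hs.2)).scomp s
      ((hasDerivAt_id s).const_sub t)
  have h2 := (hasDerivAt_inner_clm_apply (mulEdge hm) (inner_mulEdge_comm hm) h1
    (hT.hasDerivAt_orbit hg hs.1)).div_const 2
  refine h2.congr_deriv ?_
  rw [map_smul, inner_smul_right]
  ring

/-- By the weak form of the curvature condition, `e^{-2Ks} ⟪Γ(P_{t-s} f), P_s g⟫` is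
nondecreasing in `s`; its values at the endpoints are compared. -/
theorem CD.tsum_gamma_orbit_le (hG : G.Complete) (hm : G.NonDegenerate) {K : ℝ} (hCD : G.CD K)
    {f f₁ f₂ g g' : G.L2} (hf : (f, f₁) ∈ G.laplacianGraph) (hf₁ : (f₁, f₂) ∈ G.laplacianGraph)
    (hg : (g, g') ∈ G.laplacianGraph) (hg0 : ∀ x, 0 ≤ g x) {t : ℝ} (ht : 0 ≤ t) :
    ∑' y, G.m y * (G.gamma (G.heatSemigroup.orbit f t) y * g y) ≤
      Real.exp (-2 * K * t) *
        ∑' y, G.m y * (G.gamma f y * G.heatSemigroup.orbit g t y) := by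
  have hT := heatSemigroup_hasGenerator hG
  set F : ℝ → ℝ := fun s => ∑' y, G.m y *
    (G.gamma (G.heatSemigroup.orbit f (t - s)) y * G.heatSemigroup.orbit g s y) with hF
  have hd : ∀ s ∈ Set.Ioo 0 t, ∃ F' : ℝ,
      HasDerivAt (fun s => Real.exp (-2 * K * s) * F s) F' s ∧ 0 ≤ F' := by
    intro s hs
    have h3 : HasDerivAt (fun s => Real.exp (-2 * K * s)) (Real.exp (-2 * K * s) * (-2 * K)) s := by
      simpa using ((hasDerivAt_id s).const_mul (-2 * K)).exp
    refine ⟨_, h3.mul (hasDerivAt_tsum_gamma_orbit hG hm hf hf₁ hg hs), ?_⟩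
    have h4 := mul_nonneg (Real.exp_pos (-2 * K * s)).le (sub_nonneg.2
      (hCD.weak hG hm (hT.orbit_mem hf (t - s)) (hT.orbit_mem hf₁ (t - s)).1.2.1
        (hT.orbit_mem hg s) (orbit_nonneg hG hg hg0 hs.1.le)))
    rw [hF]
    linarith
  have hcont : Continuous F := continuous_tsum_gamma_orbit hG hm hf g t
  have hmono : MonotoneOn (fun s => Real.exp (-2 * K * s) * F s) (Set.Icc 0 t) := by
    refine monotoneOn_of_deriv_nonneg (convex_Icc 0 t) (Continuous.continuousOn (by fun_prop))
      ?_ ?_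
    · rw [interior_Icc]
      intro s hs
      obtain ⟨F', h1, -⟩ := hd s hs
      exact h1.differentiableAt.differentiableWithinAt
    · rw [interior_Icc]
      intro s hs
      obtain ⟨F', h1, h2⟩ := hd s hs
      rwa [h1.deriv]
  have h1 := hmono (Set.left_mem_Icc.2 ht) (Set.right_mem_Icc.2 ht) ht
  simpa only [hF, mul_zero, Real.exp_zero, one_mul, sub_zero, sub_self, C0Semigroup.orbit_zero]
    using h1

/-- The gradient bound for finitely supported functions, obtained by testing with the indicator
function of a vertex. -/
theorem CD.gamma_orbit_le (hG : G.Complete) (hm : G.NonDegenerate) {K : ℝ} (hCD : G.CD K)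
    {f : G.L2} (hf : (Function.support f).Finite) {Γf : G.L2} (hΓ : ⇑Γf = G.gamma f) {t : ℝ}
    (ht : 0 ≤ t) (x : V) :
    G.gamma (G.heatSemigroup.orbit f t) x ≤
      Real.exp (-2 * K * t) * G.heatSemigroup.orbit Γf t x := by
  classical
  have hf₁s : (Function.support
      ⇑((memLp_of_finite (G := G) (G.finite_support_lap hf)).toLp (G.lap f))).Finite := by
    rw [coe_toLp]; exact G.finite_support_lap hf
  have hξs : (Function.support (G.vertexL2 x)).Finite := by
    rw [coe_vertexL2]
    exact (Set.finite_singleton x).subset Pi.support_single_subset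
  have hΓs : (Function.support Γf).Finite := by rw [hΓ]; exact G.finite_support_gamma hf
  have hξ := mem_laplacianGraph_of_finite hξs
  have h1 := hCD.tsum_gamma_orbit_le hG hm (mem_laplacianGraph_of_finite hf)
    (mem_laplacianGraph_of_finite hf₁s) hξ (vertexL2_nonneg x) ht
  rw [tsum_eq_single x fun y hy => by rw [coe_vertexL2, Pi.single_eq_of_ne hy]; ring, ← hΓ,
    (hasSum_inner Γf _).tsum_eq, ← inner_orbit_comm hG (mem_laplacianGraph_of_finite hΓs) hξ ht,
    inner_vertexL2, coe_vertexL2, Pi.single_eq_same, mul_one, mul_left_comm] at h1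
  exact le_of_mul_le_mul_left h1 (G.m_pos x)

theorem CD.gradientBound_of_finite (hG : G.Complete) (hm : G.NonDegenerate) {K : ℝ}
    (hCD : G.CD K) {f : V → ℝ} (hf : (Function.support f).Finite) : G.GradientBound K f := by
  refine ⟨memLp_of_finite hf, memLp_of_finite (G.finite_support_gamma hf), fun t x => ?_⟩
  rw [heat_eq_orbit, heat_eq_orbit]
  refine hCD.gamma_orbit_le hG hm ?_ ?_ t.2 x
  · rwa [coe_toLp]
  · rw [coe_toLp, coe_toLp]

end WeightedGraph

/-! ### From the gradient bound to the curvature condition, and the form domain -/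

namespace WeightedGraph

variable {V : Type*} {G : WeightedGraph V}

theorem lap_congr {f g : V → ℝ} {x : V} (hx : f x = g x) (h : ∀ y, 0 < G.μ x y → f y = g y) :
    G.lap f x = G.lap g x := by
  unfold lap
  rw [hx]
  congr 1
  exact Finset.sum_congr rfl fun y hy => by rw [h y (G.mem_nbrs.1 hy)]

theorem gammaForm_congr {f f' g g' : V → ℝ} {x : V} (hx : f x = g x)
    (h : ∀ y, 0 < G.μ x y → f y = g y) (hx' : f' x = g' x)
    (h' : ∀ y, 0 < G.μ x y → f' y = g' y) : G.gammaForm f f' x = G.gammaForm g g' x := by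
  rw [gammaForm_eq, gammaForm_eq, hx, hx']
  congr 1
  exact Finset.sum_congr rfl fun y hy => by rw [h y (G.mem_nbrs.1 hy), h' y (G.mem_nbrs.1 hy)]

/-- `Γ₂(f)(x)` only depends on the values of `f` at distance at most two from `x`. -/
theorem gammaTwo_congr {f g : V → ℝ} {x : V} (h0 : f x = g x)
    (h1 : ∀ y, 0 < G.μ x y → f y = g y)
    (h2 : ∀ y z, 0 < G.μ x y → 0 < G.μ y z → f z = g z) : G.gammaTwo f x = G.gammaTwo g x := by
  have hl0 : G.lap f x = G.lap g x := lap_congr h0 h1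
  have hl1 : ∀ y, 0 < G.μ x y → G.lap f y = G.lap g y := fun y hy =>
    lap_congr (h1 y hy) fun z => h2 y z hy
  unfold gammaTwo gammaTwoForm
  rw [gammaForm_congr (f := f) (g := g) (f' := G.lap f) (g' := G.lap g) h0 h1 hl0 hl1,
    lap_congr (f := G.gammaForm f f) (g := G.gammaForm g g) (gammaForm_congr h0 h1 h0 h1)
      fun y hy => gammaForm_congr (h1 y hy) (fun z => h2 y z hy) (h1 y hy) fun z => h2 y z hy]

/-- It suffices to verify `CD(K, ∞)` on finitely supported functions. -/
theorem CD.of_finite {K : ℝ} (h : ∀ f : V → ℝ, (Function.support f).Finite →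
    ∀ x, K * G.gamma f x ≤ G.gammaTwo f x) : G.CD K := by
  classical
  intro f x
  set S : Set V := {x} ∪ {y | 0 < G.μ x y} ∪ ⋃ y ∈ {y | 0 < G.μ x y}, {z | 0 < G.μ y z} with hS
  have hfin : S.Finite := ((Set.finite_singleton x).union (G.locallyFinite x)).union
    ((G.locallyFinite x).biUnion fun y _ => G.locallyFinite y)
  have h0 : S.indicator f x = f x := Set.indicator_of_mem (show x ∈ S from Or.inl (Or.inl rfl)) f
  have h1 : ∀ y, 0 < G.μ x y → S.indicator f y = f y := fun y hy =>
    Set.indicator_of_mem (show y ∈ S from Or.inl (Or.inr hy)) f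
  have h2 : ∀ y z, 0 < G.μ x y → 0 < G.μ y z → S.indicator f z = f z := fun y z hy hz =>
    Set.indicator_of_mem (show z ∈ S from Or.inr (Set.mem_biUnion (x := y) hy hz)) f
  have h3 := h (S.indicator f) (hfin.subset Set.support_indicator_subset) x
  rwa [gammaTwo_congr h0 h1 h2, gamma, gammaForm_congr h0 h1 h0 h1] at h3

variable [MeasurableSpace V] [DiscreteMeasurableSpace V]

theorem hasDerivWithinAt_orbit_apply (hG : G.Complete) {f g : G.L2}
    (h : (f, g) ∈ G.laplacianGraph) (x : V) :
    HasDerivWithinAt (fun s => G.heatSemigroup.orbit f s x) (g x) (Set.Ici 0) 0 := by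
  have h1 := (heatSemigroup_hasGenerator hG).hasDerivWithinAt_orbit h le_rfl
  rw [C0Semigroup.orbit_zero] at h1
  exact (G.evalCLM x).hasFDerivAt.comp_hasDerivWithinAt 0 h1

theorem hasDerivWithinAt_gamma_orbit (hG : G.Complete) {f g : G.L2}
    (h : (f, g) ∈ G.laplacianGraph) (x : V) :
    HasDerivWithinAt (fun s => G.gamma (G.heatSemigroup.orbit f s) x) (2 * G.gammaForm f g x)
      (Set.Ici 0) 0 := by
  simp only [gamma, gammaForm_eq]
  have h1 : ∀ y ∈ G.nbrs x, HasDerivWithinAt (fun s => G.μ x y *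
      (G.heatSemigroup.orbit f s y - G.heatSemigroup.orbit f s x) *
      (G.heatSemigroup.orbit f s y - G.heatSemigroup.orbit f s x) / 2)
      (2 * (G.μ x y * (f y - f x) * (g y - g x) / 2)) (Set.Ici 0) 0 := by
    intro y _
    have h2 := (hasDerivWithinAt_orbit_apply hG h y).sub (hasDerivWithinAt_orbit_apply hG h x)
    refine (((h2.const_mul (G.μ x y)).mul h2).div_const 2).congr_deriv ?_
    simp only [Pi.sub_apply, C0Semigroup.orbit_zero]
    ring
  refine ((HasDerivWithinAt.fun_sum h1).const_mul _).congr_deriv ?_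
  rw [← Finset.mul_sum]
  ring

theorem nonneg_of_hasDerivWithinAt {F : ℝ → ℝ} {F' : ℝ} (h : HasDerivWithinAt F F' (Set.Ici 0) 0)
    (h0 : F 0 = 0) (hF : ∀ s, 0 ≤ s → 0 ≤ F s) : 0 ≤ F' := by
  rw [← hasDerivWithinAt_Ioi_iff_Ici, hasDerivWithinAt_iff_tendsto_slope' (by simp)] at h
  refine ge_of_tendsto h ?_
  filter_upwards [self_mem_nhdsWithin] with s hs
  have hs' : (0 : ℝ) < s := hs
  rw [slope_def_field, h0, sub_zero, sub_zero]
  exact div_nonneg (hF s hs'.le) hs'.le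

/-- The curvature condition is the derivative of the gradient bound at `t = 0`. -/
theorem CD.of_gradientBound (hG : G.Complete) {K : ℝ}
    (h : ∀ f : V → ℝ, (Function.support f).Finite → G.GradientBound K f) : G.CD K := by
  refine CD.of_finite fun f hf x => ?_
  obtain ⟨hf2, hΓ2, hb⟩ := h f hf
  have e1 : ⇑(hf2.toLp f) = f := coe_toLp hf2
  have e2 : ⇑(hΓ2.toLp (G.gamma f)) = G.gamma f := coe_toLp hΓ2
  have hfg := mem_laplacianGraph_of_finite (f := hf2.toLp f) (by rwa [e1])
  have hΓg := mem_laplacianGraph_of_finite (f := hΓ2.toLp (G.gamma f))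
    (by rw [e2]; exact G.finite_support_gamma hf)
  have h1 := hasDerivWithinAt_gamma_orbit hG hfg x
  have h2 := hasDerivWithinAt_orbit_apply hG hΓg x
  have h3 : HasDerivAt (fun s => Real.exp (-2 * K * s)) (-2 * K) 0 := by
    simpa using ((hasDerivAt_id (0 : ℝ)).const_mul (-2 * K)).exp
  have h4 := nonneg_of_hasDerivWithinAt ((h3.hasDerivWithinAt.mul h2).sub h1)
    (by simp [C0Semigroup.orbit_zero, e1, e2]) (fun s hs => by
      have := hb s.toNNReal x
      rw [heat_eq_orbit, heat_eq_orbit, Real.coe_toNNReal s hs] at this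
      exact sub_nonneg.2 this)
  simp only [C0Semigroup.orbit_zero, coe_toLp, mul_zero, Real.exp_zero] at h4
  have h5 : G.gammaTwo f x = (G.lap (G.gamma f) x - 2 * G.gammaForm f (G.lap f) x) / 2 := by
    unfold gammaTwo gammaTwoForm gamma
    ring
  rw [h5]
  linarith

theorem tendsto_toLp {F : ℕ → V → ℝ} {f : V → ℝ} (hF : ∀ n, MemLp (F n) 2 G.vertexMeasure)
    (hf : MemLp f 2 G.vertexMeasure)
    (h : Tendsto (fun n => ∑' x, G.m x * (F n x - f x) ^ 2) atTop (𝓝 0)) :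
    Tendsto (fun n => (hF n).toLp (F n)) atTop (𝓝 (hf.toLp f)) := by
  rw [tendsto_iff_norm_sub_tendsto_zero]
  have h1 := h.sqrt
  rw [Real.sqrt_zero] at h1
  refine h1.congr fun n => ?_
  rw [← Real.sqrt_sq (norm_nonneg ((hF n).toLp (F n) - hf.toLp f)),
    ← (hasSum_norm_sq ((hF n).toLp (F n) - hf.toLp f)).tsum_eq, coe_sub, coe_toLp, coe_toLp]
  rfl

theorem continuous_gamma_apply (x : V) : Continuous fun u : G.L2 => G.gamma u x := by
  have h : ∀ y, Continuous fun u : G.L2 => u y := fun y => (G.evalCLM y).continuous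
  simp only [gamma, gammaForm_eq]
  refine continuous_const.mul (continuous_finsetSum _ fun y _ => ?_)
  exact ((continuous_const.mul ((h y).sub (h x))).mul ((h y).sub (h x))).div_const 2

/-- `f ↦ Γ(f)` is continuous from the form domain to `ℓ²`. -/
theorem tendsto_gamma (hm : G.NonDegenerate) {φ : ℕ → V → ℝ} {f : V → ℝ}
    (hφ : ∀ n, G.FiniteEnergy (φ n)) (hf : G.FiniteEnergy f)
    (h : Tendsto (fun n => G.energy (φ n - f) (φ n - f)) atTop (𝓝 0)) :
    Tendsto (fun n => ((hφ n).memLp_gamma hm).toLp (G.gamma (φ n))) atTop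
      (𝓝 ((hf.memLp_gamma hm).toLp (G.gamma f))) := by
  refine tendsto_toLp _ _ ?_
  obtain ⟨δ, hδ, hδm⟩ := hm
  have h1 : ∀ n x, G.gamma (φ n) x - G.gamma f x = G.gammaForm (φ n - f) (φ n + f) x :=
    fun n x => by
      simp only [gamma, gammaForm_sub_left, gammaForm_add_right, G.gammaForm_comm f (φ n)]
      ring
  have h2 : ∀ n, G.energy (φ n + f) (φ n + f) ≤
      2 * G.energy (φ n - f) (φ n - f) + 8 * G.energy f f := fun n => by
    have hD := (hφ n).sub hf
    have hS := (hφ n).add hf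
    have e1 := ((hD.hasSum_gammaForm hD).mul_left 2).add ((hf.hasSum_gammaForm hf).mul_left 8)
    rw [← (hS.hasSum_gammaForm hS).tsum_eq, ← e1.tsum_eq]
    refine (hS.hasSum_gammaForm hS).summable.tsum_le_tsum (fun x => ?_) e1.summable
    -- `Γ(d + 2 f) ≤ 2 Γ(d) + 8 Γ(f)` is `Γ(d - 2 f) ≥ 0`, where `d = φ n - f`
    have e2 := mul_nonneg (G.m_pos x).le (G.gamma_nonneg ((φ n - f) - (f + f)) x)
    have e3 : φ n + f = (φ n - f) + (f + f) := by abel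
    rw [e3]
    set d := φ n - f
    simp only [gamma, gammaForm_sub_left, gammaForm_add_left, gammaForm_sub_right,
      gammaForm_add_right, G.gammaForm_comm f d] at e2 ⊢
    linarith
  have h3 : Tendsto (fun n => δ⁻¹ * (G.energy (φ n - f) (φ n - f) *
      (2 * G.energy (φ n - f) (φ n - f) + 8 * G.energy f f))) atTop (𝓝 0) := by
    simpa using (h.mul ((h.const_mul 2).add_const (8 * G.energy f f))).const_mul δ⁻¹
  refine squeeze_zero (fun n => tsum_nonneg fun x =>
    mul_nonneg (G.m_pos x).le (sq_nonneg _)) (fun n => ?_) h3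
  simp only [h1]
  refine (((hφ n).sub hf).gammaForm_sq_bound hδ hδm ((hφ n).add hf)).2.trans ?_
  exact mul_le_mul_of_nonneg_left (mul_le_mul_of_nonneg_left (h2 n) (energy_self_nonneg _))
    (inv_pos.2 hδ).le

/-- The gradient bound passes from finitely supported functions to the form domain. -/
theorem gradientBound_of_mem_formDomain (hm : G.NonDegenerate) {K : ℝ}
    (h : ∀ f : V → ℝ, (Function.support f).Finite → G.GradientBound K f) {f : V → ℝ}
    (hf : f ∈ G.formDomain) : G.GradientBound K f := by
  obtain ⟨hf2, hfE, φ, hφ, hlim⟩ := hf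
  have hp : ∀ n, 0 ≤ G.pairing (φ n - f) (φ n - f) := fun n => tsum_nonneg fun x => by
    rw [mul_assoc]
    exact mul_nonneg (G.m_pos x).le (mul_self_nonneg _)
  have h1 : Tendsto (fun n => G.pairing (φ n - f) (φ n - f)) atTop (𝓝 0) :=
    squeeze_zero hp (fun n => le_add_of_nonneg_right (energy_self_nonneg _)) hlim
  have h2 : Tendsto (fun n => G.energy (φ n - f) (φ n - f)) atTop (𝓝 0) :=
    squeeze_zero (fun n => energy_self_nonneg _) (fun n => le_add_of_nonneg_left (hp n)) hlim
  have h3 : Tendsto (fun n => (memLp_of_finite (G := G) (hφ n)).toLp (φ n)) atTop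
      (𝓝 (hf2.toLp f)) := by
    refine tendsto_toLp _ _ (h1.congr fun n => tsum_congr fun x => ?_)
    simp only [Pi.sub_apply]
    ring
  have h4 := tendsto_gamma hm (fun n => finiteEnergy_of_finite (hφ n)) hfE h2
  refine ⟨hf2, hfE.memLp_gamma hm, fun t x => ?_⟩
  have h5 := ((continuous_gamma_apply (G := G) x).comp (G.heatSemigroup.op t).continuous).tendsto
    (hf2.toLp f) |>.comp h3
  have h6 := (((G.evalCLM x).continuous.comp (G.heatSemigroup.op t).continuous).tendsto
    ((hfE.memLp_gamma hm).toLp (G.gamma f)) |>.comp h4).const_mul (Real.exp (-2 * K * t))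
  exact le_of_tendsto_of_tendsto' h5 h6 fun n => (h (φ n) (hφ n)).choose_spec.choose_spec t x

end WeightedGraph

theorem mainTheorem1 {V : Type*} [MeasurableSpace V] [DiscreteMeasurableSpace V]
    (G : WeightedGraph V) (hconn : G.Connected) (hcomplete : G.Complete)
    (hm : G.NonDegenerate) (K : ℝ) :
    List.TFAE
      [G.CD K,
        ∀ f : V → ℝ, (Function.support f).Finite → G.GradientBound K f,
        ∀ f ∈ G.formDomain, G.GradientBound K f] := by
  tfae_have 1 → 2 := fun h f hf => h.gradientBound_of_finite hcomplete hm hf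
  tfae_have 2 → 1 := fun h => WeightedGraph.CD.of_gradientBound hcomplete h
  tfae_have 2 → 3 := fun h f hf => WeightedGraph.gradientBound_of_mem_formDomain hm h hf
  tfae_have 3 → 2 := fun h f hf => h f (WeightedGraph.mem_formDomain_of_finite hf)
  tfae_finish
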